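/- Let $d \in \mathbb{N}$ and fix a window $\phi \in \mathcal{S}(\mathbb{R}^d)$. For $f \in \mathcal{S}'(\mathbb{R}^d)$ and $x,\xi\in\mathbb{R}^d$ let $$V_\phi f(x,\xi) = \langle f, M_\xi T_x \phi\rangle, \qquad M_\xi T_x\phi(t) = e^{2\pi i t\cdot \xi}\phi(t-x),$$ where $\langle\cdot,\cdot\rangle$ extends the $L^2$ inner product $\int f\bar g$ (conjugate linear in the second argument). For a permutation $c$ of $\{1,\dots,2d\}$ let $\mathfrak{c}(x_1,\dots,x_{2d}) = (x_{c(1)},\dots,x_{c(2d)})$. For $p_1,\dots,p_{2d}\in[1,\infty]$ and a weight $w$ on $\mathbb{R}^{2d}$ let $$\|F\|_{L_w^{p_1,\dots,p_{2d}}} = \Bigl(\int_{\mathbb{R}} \cdots \Bigl(\int_{\mathbb{R}} |F(x_1,\dots,x_{2d})\,w(x_1,\dots,x_{2d})|^{p_1}\,dx_1\Bigr)^{p_2/p_1}\cdots\,dx_{2d}\Bigr)^{1/p_{2d}},$$ with the essential supremum in the $i$-th variable when $p_i=\infty$, and let $M(c)_w^{p_1,\dots,p_{2d}}$ be the mixed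 modulation space of all $f\in\mathcal{S}'(\mathbb{R}^d)$ with $\|V_\phi f\circ\mathfrak{c}\|_{L_w^{p_1,\dots,p_{2d}}}<\infty$. For $s \in \mathbb{R}$ let $v_s(z) = (1+|z|)^s$, $z\in\mathbb{R}^{2d}$. If $s\ge t$ are real numbers and $p_i, r_i\in[1,\infty]$ satisfy $p_i\le r_i$ for all $i=1,\dots,2d$, then $$M(c)_{v_s}^{p_1,p_2,\dots,p_{2d}} \subseteq M(c)_{v_t}^{r_1,r_2,\dots,r_{2d}}.$$ -/

import Mathlib

open MeasureTheory SchwartzMap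
open scoped ENNReal ComplexConjugate

noncomputable section

/-- The character `t ↦ e^{2π i t·ξ}` on `ℝ^d`. -/
def tfCharacter {d : ℕ} (ξ t : EuclideanSpace ℝ (Fin d)) : ℂ :=
  Complex.exp (2 * Real.pi * Complex.I * (inner ℝ t ξ : ℝ))

theorem tfCharacter_hasTemperateGrowth {d : ℕ} (ξ : EuclideanSpace ℝ (Fin d)) :
    (tfCharacter ξ).HasTemperateGrowth := by
  have h1 : (fun r : ℝ => Complex.exp ((2 * Real.pi * Complex.I) * (r : ℂ))).HasTemperateGrowth := by
    refine ⟨?_, fun n => ⟨0, (2 * Real.pi) ^ n, fun r => ?_⟩⟩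
    · exact Complex.contDiff_exp.comp (contDiff_const.mul Complex.ofRealCLM.contDiff)
    · have h : ∀ m : ℕ, iteratedDeriv m
          (fun r : ℝ => Complex.exp ((2 * Real.pi * Complex.I) * (r : ℂ))) =
          fun r : ℝ => (2 * Real.pi * Complex.I) ^ m *
            Complex.exp ((2 * Real.pi * Complex.I) * (r : ℂ)) := by
        intro m
        induction m with
        | zero => simp
        | succ k ih =>
          rw [iteratedDeriv_succ, ih]
          funext r
          have h3 : HasDerivAt (fun r : ℝ => (2 * Real.pi * Complex.I) * (r : ℂ))
              (2 * Real.pi * Complex.I) r := by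
            simpa using (Complex.ofRealCLM.hasDerivAt (x := r)).const_mul
              (2 * Real.pi * Complex.I)
          rw [(h3.cexp.const_mul _).deriv]
          ring
      rw [norm_iteratedFDeriv_eq_norm_iteratedDeriv, h n]
      have h2 : ‖Complex.exp ((2 * Real.pi * Complex.I) * (r : ℂ))‖ = 1 := by
        rw [Complex.norm_exp]; simp
      simp [h2, abs_of_pos Real.pi_pos]
  exact h1.comp (Function.hasTemperateGrowth_inner_left ξ)

/-- Translation `T_x φ(t) = φ(t - x)`. -/
def tfTranslate {d : ℕ} (x : EuclideanSpace ℝ (Fin d))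
    (φ : SchwartzMap (EuclideanSpace ℝ (Fin d)) ℂ) :
    SchwartzMap (EuclideanSpace ℝ (Fin d)) ℂ :=
  SchwartzMap.compSubConstCLM ℂ x φ

/-- Modulation `M_ξ φ(t) = e^{2π i t·ξ} φ(t)`. -/
def tfModulate {d : ℕ} (ξ : EuclideanSpace ℝ (Fin d))
    (φ : SchwartzMap (EuclideanSpace ℝ (Fin d)) ℂ) :
    SchwartzMap (EuclideanSpace ℝ (Fin d)) ℂ :=
  SchwartzMap.smulLeftCLM ℂ (tfCharacter ξ) φ

/-- The complex conjugate of a Schwartz function. -/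
def schwartzConj {d : ℕ} (φ : SchwartzMap (EuclideanSpace ℝ (Fin d)) ℂ) :
    SchwartzMap (EuclideanSpace ℝ (Fin d)) ℂ :=
  SchwartzMap.postcompCLM (Complex.conjCLE : ℂ →L[ℝ] ℂ) φ

theorem tfTranslate_apply {d : ℕ} (x t : EuclideanSpace ℝ (Fin d))
    (φ : SchwartzMap (EuclideanSpace ℝ (Fin d)) ℂ) :
    tfTranslate x φ t = φ (t - x) := rfl

theorem tfModulate_apply {d : ℕ} (ξ t : EuclideanSpace ℝ (Fin d))
    (φ : SchwartzMap (EuclideanSpace ℝ (Fin d)) ℂ) :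
    tfModulate ξ φ t = Complex.exp (2 * Real.pi * Complex.I * (inner ℝ t ξ : ℝ)) * φ t :=
  SchwartzMap.smulLeftCLM_apply_apply (tfCharacter_hasTemperateGrowth ξ) φ t

theorem schwartzConj_apply {d : ℕ} (φ : SchwartzMap (EuclideanSpace ℝ (Fin d)) ℂ)
    (t : EuclideanSpace ℝ (Fin d)) : schwartzConj φ t = conj (φ t) := rfl

/-- The pairing `⟨f, g⟩` of a tempered distribution with a Schwartz function: the extension of the
`L²` inner product `∫ f ḡ`, hence conjugate linear in `g`. -/
def temperedPairing {d : ℕ} (f : TemperedDistribution (EuclideanSpace ℝ (Fin d)) ℂ)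
    (g : SchwartzMap (EuclideanSpace ℝ (Fin d)) ℂ) : ℂ :=
  f (schwartzConj g)

/-- The Gabor transform `V_φ f (x, ξ) = ⟨f, M_ξ T_x φ⟩`, as a function on `ℝ^{2d}`: the first `d`
coordinates of the argument are `x`, the last `d` are `ξ`. -/
def gaborTransform {d : ℕ} (φ : SchwartzMap (EuclideanSpace ℝ (Fin d)) ℂ)
    (f : TemperedDistribution (EuclideanSpace ℝ (Fin d)) ℂ) (z : Fin (d + d) → ℝ) : ℂ :=
  temperedPairing f
    (tfModulate (WithLp.toLp 2 fun i => z (Fin.natAdd d i))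
      (tfTranslate (WithLp.toLp 2 fun i => z (Fin.castAdd d i)) φ))

/-- The iterated norm of a nonnegative function on `ℝ^n`: the `L^{p_1}` norm in the first variable
(innermost), then the `L^{p_2}` norm in the second, and so on up to the `L^{p_n}` norm in the last
variable (outermost), all with respect to Lebesgue measure on `ℝ`; for `p_i = ∞` this is the
essential supremum in that variable. -/
def iteratedLpNorm : (n : ℕ) → (Fin n → ℝ≥0∞) → ((Fin n → ℝ) → ℝ≥0∞) → ℝ≥0∞
  | 0, _, F => F default
  | n + 1, p, F =>
    eLpNorm
      (fun t : ℝ => iteratedLpNorm n (fun i => p i.castSucc)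
        (fun x => F (Fin.snoc (α := fun _ => ℝ) x t)))
      (p (Fin.last n)) volume

/-- The weighted mixed norm `‖F‖_{L_w^{p_1,…,p_n}}` of `F : ℝ^n → ℂ`. -/
def mixedLpNorm {n : ℕ} (w : (Fin n → ℝ) → ℝ) (p : Fin n → ℝ≥0∞)
    (F : (Fin n → ℝ) → ℂ) : ℝ≥0∞ :=
  iteratedLpNorm n p (fun x => ‖F x * (w x : ℂ)‖ₑ)

/-- The weight `v_s(z) = (1 + |z|)^s`, with `|z|` the Euclidean norm. -/
def polyWeight {n : ℕ} (s : ℝ) (z : Fin n → ℝ) : ℝ :=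
  (1 + ‖(WithLp.toLp 2 z : EuclideanSpace ℝ (Fin n))‖) ^ s

/-- The bijection `(x_1, …, x_n) ↦ (x_{c(1)}, …, x_{c(n)})` of `ℝ^n`. -/
def permuteCoords {n : ℕ} (c : Equiv.Perm (Fin n)) (x : Fin n → ℝ) : Fin n → ℝ :=
  fun i => x (c i)

/-- The norm `‖V_φ f ∘ 𝔠‖_{L_w^{p_1,…,p_{2d}}}`, where `φ` is the window. -/
def mixedModulationNorm {d : ℕ} (φ : SchwartzMap (EuclideanSpace ℝ (Fin d)) ℂ)
    (c : Equiv.Perm (Fin (d + d))) (w : (Fin (d + d) → ℝ) → ℝ) (p : Fin (d + d) → ℝ≥0∞)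
    (f : TemperedDistribution (EuclideanSpace ℝ (Fin d)) ℂ) : ℝ≥0∞ :=
  mixedLpNorm w p (gaborTransform φ f ∘ permuteCoords c)

/-- The mixed modulation space `M(c)_w^{p_1,…,p_{2d}}` with window `φ`. -/
def mixedModulationSpace {d : ℕ} (φ : SchwartzMap (EuclideanSpace ℝ (Fin d)) ℂ)
    (c : Equiv.Perm (Fin (d + d))) (w : (Fin (d + d) → ℝ) → ℝ) (p : Fin (d + d) → ℝ≥0∞) :
    Set (TemperedDistribution (EuclideanSpace ℝ (Fin d)) ℂ) :=
  {f | mixedModulationNorm φ c w p f < ∞}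

end

/-! Everything follows from one pointwise inequality and one estimate for mixed norms. For `z, w` in
phase space, the time-frequency shifts at `z` and `w` compose to the shift at `z + w` up to a
unimodular factor. Applying `f` to the reproducing formula `‖φ‖² φ = ∫ V_φ φ(w) M_ξ T_x φ dw`,
shifted by `z`, therefore gives `‖φ‖² |V_φ f(z)| ≤ ∫ |V_φ φ(w)| |V_φ f(z + w)| dw`
(`integral_norm_sq_mul_enorm_gaborTransform_le`).

Since `φ` is Schwartz, `V_φ φ` decays faster than any power of `∏ (1 + |w_i|)`
(`exists_gaborKernel_mul_prod_le`). The weight `v_s` is moderate and dominates `v_t`, so part of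
this decay pays for moving the weight from `z` to `z + w`, and what remains is the tensor product of
the densities `(1 + |w_i|)⁻²`. This kernel does not see the permutation of coordinates. Thus `|V_φ f
∘ 𝔠| v_t` is at most a constant times an average of translates of `|V_φ f ∘ 𝔠| v_s` against a finite
product measure (`exists_weighted_gaborTransform_le`).

Such averages map the mixed `L^p` space to the mixed `L^r` space whenever `p_i ≤ r_i`
(`exists_iteratedLpNorm_lintegral_translate_le`). In one variable, averaging against a finite
measure dominated by Lebesgue measure maps `L^p` to `L^∞` by Hölder and to `L^p` by Minkowski, hence
to `L^r`. Because the kernel is a tensor product, Minkowski's inequality reduces several variables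
to one at a time.

The analytic cost lies in applying `f` under the integral: the Schwartz space is not normed, so the
integral is taken in a finite product of Banach spaces through which `f` factors
(`apply_eq_integral_of_eq_integral`). -/

/-! ### Mixed norms: measurability and Minkowski's integral inequality -/

theorem measurable_eLpNorm_right {X α : Type*} [MeasurableSpace X] [MeasurableSpace α]
    (μ : Measure α) [SFinite μ] (p : ℝ≥0∞) {Q : X → α → ℝ≥0∞}
    (hQ : Measurable (Function.uncurry Q)) :
    Measurable fun x => eLpNorm (Q x) p μ := by
  rcases eq_or_ne p 0 with rfl | hp0
  · simp
  rcases eq_or_ne p ∞ with rfl | hpt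
  · simp only [eLpNorm_exponent_top, eLpNormEssSup, enorm_eq_self]
    refine measurable_of_Ioi fun a => ?_
    -- The essential supremum exceeds `a` exactly when the superlevel set of the section has
    -- positive measure, and measures of sections are measurable.
    have : (fun x => essSup (Q x) μ) ⁻¹' Set.Ioi a
        = (fun x => μ (Prod.mk x ⁻¹' {z : X × α | a < Function.uncurry Q z})) ⁻¹' Set.Ioi 0 := by
      ext x
      simp only [Set.mem_preimage, Set.mem_Ioi, pos_iff_ne_zero]
      rw [← not_le, not_iff_not]
      constructor
      · intro h
        have := ENNReal.ae_le_essSup (μ := μ) (Q x)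
        refine measure_mono_null ?_ (ae_iff.1 this)
        intro y hy
        simp only [Set.mem_preimage, Set.mem_ofPred_eq, Function.uncurry_apply_pair] at hy ⊢
        exact not_le.2 (h.trans_lt hy)
      · intro h
        refine essSup_le_of_ae_le a (ae_iff.2 ?_)
        simpa using h
    rw [this]
    exact measurable_measure_prodMk_left (measurableSet_lt measurable_const hQ) measurableSet_Ioi
  · simp_rw [eLpNorm_eq_lintegral_rpow_enorm_toReal hp0 hpt, enorm_eq_self]
    refine Measurable.pow_const ?_ _
    exact Measurable.lintegral_prod_right' (f := fun z => Function.uncurry Q z ^ p.toReal)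
      (hQ.pow_const _)

/-- Minkowski's integral inequality. For finite `p`, integrate the normalized functions `Q(·, s) / A
s`, with `A s` the norm of `Q(·, s)`, against `A · ν`, whose total mass is the right-hand side `M`.
Hölder on this finite measure and Tonelli then give the claim without duality. -/
theorem eLpNorm_lintegral_le {α β : Type*} [MeasurableSpace α] [MeasurableSpace β]
    (μ : Measure α) [SFinite μ] (ν : Measure β) [SFinite ν] {p : ℝ≥0∞} (hp : 1 ≤ p)
    {Q : α → β → ℝ≥0∞} (hQ : Measurable (Function.uncurry Q)) :
    eLpNorm (fun x => ∫⁻ s, Q x s ∂ν) p μ ≤ ∫⁻ s, eLpNorm (fun x => Q x s) p μ ∂ν := by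
  have hp0 : p ≠ 0 := (zero_lt_one.trans_le hp).ne'
  set A : β → ℝ≥0∞ := fun s => eLpNorm (fun x => Q x s) p μ with hA
  have hQ' : Measurable (Function.uncurry fun s x => Q x s) := hQ.comp measurable_swap
  have hAm : Measurable A := measurable_eLpNorm_right μ p hQ'
  have hQx : ∀ x, Measurable (Q x) := fun x => hQ.comp measurable_prodMk_left
  have hQs : ∀ s, Measurable fun x => Q x s := fun s => hQ.comp measurable_prodMk_right
  rcases eq_or_ne p ∞ with rfl | hpt
  · have h1 : ∀ᵐ s ∂ν, ∀ᵐ x ∂μ, Q x s ≤ A s := ae_of_all _ fun s => by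
      simpa [hA, eLpNormEssSup] using ENNReal.ae_le_essSup (μ := μ) (fun x => Q x s)
    have h2 : ∀ᵐ x ∂μ, ∀ᵐ s ∂ν, Q x s ≤ A s :=
      (Measure.ae_ae_comm (p := fun s x => Q x s ≤ A s)
        (measurableSet_le hQ' (hAm.comp measurable_fst))).1 h1
    rw [eLpNorm_exponent_top]
    refine eLpNormEssSup_le_of_ae_enorm_bound ?_
    filter_upwards [h2] with x hx
    exact lintegral_mono_ae hx
  by_cases hM : ∫⁻ s, A s ∂ν = ∞
  · rw [hM]; exact le_top
  set P := p.toReal with hP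
  have hP1 : 1 ≤ P := by simpa using ENNReal.toReal_mono hpt hp
  have hP0 : 0 < P := by linarith
  set M := ∫⁻ s, A s ∂ν with hMdef
  set ν' := ν.withDensity A with hν'
  have hν'u : ν' Set.univ = M := by simp [hν', hMdef]
  have hAt : ∀ᵐ s ∂ν, A s ≠ ∞ := (ae_lt_top hAm hM).mono fun s hs => hs.ne
  -- Where `A s = 0` the division is degenerate, but there `Q x s` vanishes for almost every `x`.
  -- The exceptional set depends on `s`, so the quantifiers are exchanged by Fubini in `h2`.
  have h1 : ∀ᵐ s ∂ν, ∀ᵐ x ∂μ, Q x s ≤ A s * (Q x s / A s) := by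
    filter_upwards [hAt] with s hs
    by_cases h0 : A s = 0
    · have : (fun x => Q x s) =ᵐ[μ] 0 :=
        (eLpNorm_eq_zero_iff (hQs s).aestronglyMeasurable hp0).1 h0
      filter_upwards [this] with x hx
      simp [hx]
    · exact ae_of_all _ fun x => (ENNReal.mul_div_cancel h0 hs).ge
  have hm : Measurable (Function.uncurry fun s x => A s * (Q x s / A s)) :=
    (hAm.comp measurable_fst).mul (hQ'.div (hAm.comp measurable_fst))
  have h2 : ∀ᵐ x ∂μ, ∀ᵐ s ∂ν, Q x s ≤ A s * (Q x s / A s) :=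
    (Measure.ae_ae_comm (p := fun s x => Q x s ≤ A s * (Q x s / A s))
      (measurableSet_le hQ' hm)).1 h1
  have h3 : ∀ᵐ x ∂μ, (∫⁻ s, Q x s ∂ν) ^ P ≤
      (∫⁻ s, (Q x s / A s) ^ P ∂ν') * M ^ (P - 1) := by
    filter_upwards [h2] with x hx
    have hmx : Measurable fun s => Q x s / A s := (hQx x).div hAm
    have e1 : ∫⁻ s, Q x s ∂ν ≤ ∫⁻ s, Q x s / A s ∂ν' := by
      rw [hν', lintegral_withDensity_eq_lintegral_mul _ hAm hmx]
      exact lintegral_mono_ae hx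
    have e2 := eLpNorm_le_eLpNorm_mul_rpow_measure_univ hp
      (hmx.aestronglyMeasurable (μ := ν'))
    rw [eLpNorm_one_eq_lintegral_enorm, hν'u,
      eLpNorm_eq_lintegral_rpow_enorm_toReal hp0 hpt] at e2
    simp only [enorm_eq_self, ENNReal.toReal_one] at e2
    calc _ ≤ ((∫⁻ s, (Q x s / A s) ^ P ∂ν') ^ (1 / P) * M ^ (1 / 1 - 1 / P)) ^ P :=
          ENNReal.rpow_le_rpow (e1.trans e2) hP0.le
      _ = _ := by
          rw [ENNReal.mul_rpow_of_nonneg _ _ hP0.le, ← ENNReal.rpow_mul, ← ENNReal.rpow_mul]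
          congr 2
          · field_simp; simp
          · field_simp
  have h4 : ∫⁻ x, (∫⁻ s, Q x s ∂ν) ^ P ∂μ ≤ M ^ P := by
    have hmm : Measurable (Function.uncurry fun x s => (Q x s / A s) ^ P) :=
      (hQ.div (hAm.comp measurable_snd)).pow_const _
    calc _ ≤ ∫⁻ x, (∫⁻ s, (Q x s / A s) ^ P ∂ν') * M ^ (P - 1) ∂μ := lintegral_mono_ae h3
      _ = (∫⁻ x, ∫⁻ s, (Q x s / A s) ^ P ∂ν' ∂μ) * M ^ (P - 1) :=
          lintegral_mul_const _ hmm.lintegral_prod_right'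
      _ = (∫⁻ s, ∫⁻ x, (Q x s / A s) ^ P ∂μ ∂ν') * M ^ (P - 1) := by
          rw [lintegral_lintegral_swap hmm.aemeasurable]
      _ = (∫⁻ s, A s * ∫⁻ x, (Q x s / A s) ^ P ∂μ ∂ν) * M ^ (P - 1) := by
          rw [hν', lintegral_withDensity_eq_lintegral_mul (g := fun s => ∫⁻ x, (Q x s / A s) ^ P ∂μ)
            _ hAm (hmm.comp measurable_swap).lintegral_prod_right']
          rfl
      _ ≤ M * M ^ (P - 1) := by
          gcongr
          refine lintegral_mono fun s => ?_
          have hAP : ∫⁻ x, Q x s ^ P ∂μ = A s ^ P := by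
            simp only [hA, eLpNorm_eq_lintegral_rpow_enorm_toReal hp0 hpt, enorm_eq_self]
            rw [← ENNReal.rpow_mul, ← hP, one_div_mul_cancel hP0.ne', ENNReal.rpow_one]
          simp_rw [div_eq_mul_inv, ENNReal.mul_rpow_of_nonneg _ _ hP0.le]
          rw [lintegral_mul_const _ ((hQs s).pow_const _), hAP,
            ← ENNReal.mul_rpow_of_nonneg _ _ hP0.le]
          -- Only an inequality: the product is `0` when `A s` is `0` or `∞`.
          have : (A s * (A s)⁻¹) ^ P ≤ 1 :=
            ENNReal.rpow_le_one (ENNReal.mul_inv_le_one _) hP0.le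
          calc _ ≤ A s * 1 := by gcongr
            _ = A s := mul_one _
      _ = M ^ P := by
          rcases eq_or_ne M 0 with h0 | h0
          · simp [h0, hP0]
          · conv_rhs => rw [show P = 1 + (P - 1) by ring, ENNReal.rpow_add _ _ h0 hM,
              ENNReal.rpow_one]
  rw [eLpNorm_eq_lintegral_rpow_enorm_toReal hp0 hpt]
  simp only [enorm_eq_self]
  calc _ ≤ (M ^ P) ^ (1 / P) := ENNReal.rpow_le_rpow h4 (by positivity)
    _ = M := by rw [← ENNReal.rpow_mul, mul_one_div_cancel hP0.ne', ENNReal.rpow_one]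

theorem measurable_snoc {n : ℕ} :
    Measurable fun z : (Fin n → ℝ) × ℝ => (Fin.snoc (α := fun _ => ℝ) z.1 z.2 : Fin (n + 1) → ℝ) := by
  refine measurable_pi_iff.2 fun i => ?_
  refine Fin.lastCases ?_ (fun j => ?_) i
  · simpa using measurable_snd
  · simpa using! (measurable_pi_apply j).comp measurable_fst

/-- The parameter space is arbitrary because the induction step moves the outermost variable into
it. -/
theorem measurable_iteratedLpNorm {n : ℕ} (p : Fin n → ℝ≥0∞) {X : Type*} [MeasurableSpace X]
    {Q : X → (Fin n → ℝ) → ℝ≥0∞} (hQ : Measurable (Function.uncurry Q)) :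
    Measurable fun x => iteratedLpNorm n p (Q x) := by
  induction n generalizing X with
  | zero => exact hQ.comp (measurable_id.prodMk measurable_const)
  | succ n ih =>
    refine measurable_eLpNorm_right volume _
      (Q := fun x t => iteratedLpNorm n _ fun y => Q x (Fin.snoc (α := fun _ => ℝ) y t)) ?_
    refine ih (X := X × ℝ) _ (Q := fun z y => Q z.1 (Fin.snoc (α := fun _ => ℝ) y z.2)) ?_
    exact hQ.comp ((measurable_fst.comp measurable_fst).prodMk
      (measurable_snoc.comp (measurable_snd.prodMk (measurable_snd.comp measurable_fst))))

theorem iteratedLpNorm_mono {n : ℕ} (p : Fin n → ℝ≥0∞) {F G : (Fin n → ℝ) → ℝ≥0∞}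
    (h : ∀ x, F x ≤ G x) : iteratedLpNorm n p F ≤ iteratedLpNorm n p G := by
  induction n with
  | zero => exact h _
  | succ n ih =>
    refine eLpNorm_mono_enorm fun t => ?_
    simp only [enorm_eq_self]
    exact ih _ fun x => h _

theorem iteratedLpNorm_const_mul_le {n : ℕ} (p : Fin n → ℝ≥0∞) {C : ℝ≥0∞} (hC : C ≠ ∞)
    (F : (Fin n → ℝ) → ℝ≥0∞) :
    iteratedLpNorm n p (fun x => C * F x) ≤ C * iteratedLpNorm n p F := by
  lift C to NNReal using hC
  induction n with
  | zero => exact le_rfl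
  | succ n ih =>
    refine eLpNorm_le_nnreal_smul_eLpNorm_of_ae_le_mul' (ae_of_all _ fun t => ?_) _
    simp only [enorm_eq_self]
    exact ih _ _

/-- Minkowski's inequality is applied to one variable at a time, from the innermost norm outwards.
-/
theorem iteratedLpNorm_lintegral_le {n : ℕ} {p : Fin n → ℝ≥0∞} (hp : ∀ i, 1 ≤ p i)
    {β : Type*} [MeasurableSpace β] (ν : Measure β) [SFinite ν]
    {Q : (Fin n → ℝ) → β → ℝ≥0∞} (hQ : Measurable (Function.uncurry Q)) :
    iteratedLpNorm n p (fun x => ∫⁻ s, Q x s ∂ν)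
      ≤ ∫⁻ s, iteratedLpNorm n p (fun x => Q x s) ∂ν := by
  induction n with
  | zero => exact le_rfl
  | succ n ih =>
    have hsn : ∀ t : ℝ, Measurable fun y : Fin n → ℝ =>
        (Fin.snoc (α := fun _ => ℝ) y t : Fin (n + 1) → ℝ) := fun t =>
      measurable_snoc.comp measurable_prodMk_right
    refine (eLpNorm_mono_enorm (g := fun t => ∫⁻ s, iteratedLpNorm n (fun i => p i.castSucc)
      (fun x => Q (Fin.snoc (α := fun _ => ℝ) x t) s) ∂ν) fun t => ?_).trans
      (eLpNorm_lintegral_le volume ν (hp _) ?_)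
    · simp only [enorm_eq_self]
      refine ih (fun i => hp _) (Q := fun x s => Q (Fin.snoc (α := fun _ => ℝ) x t) s) ?_
      exact hQ.comp (((hsn t).comp measurable_fst).prodMk measurable_snd)
    · refine measurable_iteratedLpNorm (X := ℝ × β) _
        (Q := fun z x => Q (Fin.snoc (α := fun _ => ℝ) x z.1) z.2) ?_
      exact hQ.comp ((measurable_snoc.comp (measurable_snd.prodMk
        (measurable_fst.comp measurable_fst))).prodMk (measurable_snd.comp measurable_fst))

/-! ### Averages of translates: from `L^p` to `L^r` -/

/-- Interpolation between `L^p` and `L^∞`: for finite `r`, `F ^ r = F ^ (r - p) * F ^ p ≤ B ^ (r -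
p) * F ^ p`. -/
theorem eLpNorm_le_of_le_of_eLpNorm_le {α : Type*} [MeasurableSpace α] {μ : Measure α}
    {p r B : ℝ≥0∞} (hp : 1 ≤ p) (hpr : p ≤ r) {F : α → ℝ≥0∞} (hF : ∀ x, F x ≤ B)
    (hFp : eLpNorm F p μ ≤ B) : eLpNorm F r μ ≤ B := by
  rcases eq_or_ne B ∞ with rfl | hB
  · exact le_top
  rcases eq_or_ne r ∞ with rfl | hr
  · rw [eLpNorm_exponent_top]
    exact eLpNormEssSup_le_of_ae_enorm_bound (ae_of_all _ fun x => by simpa using hF x)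
  have hpt : p ≠ ∞ := ne_top_of_le_ne_top hr hpr
  have hp0 : p ≠ 0 := (zero_lt_one.trans_le hp).ne'
  have hr0 : r ≠ 0 := (zero_lt_one.trans_le (hp.trans hpr)).ne'
  have hP0 : 0 < p.toReal := ENNReal.toReal_pos hp0 hpt
  have hR0 : 0 < r.toReal := ENNReal.toReal_pos hr0 hr
  have hPR : p.toReal ≤ r.toReal := ENNReal.toReal_mono hr hpr
  rw [eLpNorm_eq_lintegral_rpow_enorm_toReal hp0 hpt, one_div, ENNReal.rpow_inv_le_iff hP0] at hFp
  rw [eLpNorm_eq_lintegral_rpow_enorm_toReal hr0 hr, one_div, ENNReal.rpow_inv_le_iff hR0]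
  simp only [enorm_eq_self] at hFp ⊢
  calc ∫⁻ x, F x ^ r.toReal ∂μ ≤ ∫⁻ x, B ^ (r.toReal - p.toReal) * F x ^ p.toReal ∂μ := by
        refine lintegral_mono fun x => ?_
        calc F x ^ r.toReal = F x ^ ((r.toReal - p.toReal) + p.toReal) := by ring_nf
          _ = F x ^ (r.toReal - p.toReal) * F x ^ p.toReal :=
            ENNReal.rpow_add_of_nonneg _ _ (sub_nonneg.2 hPR) hP0.le
          _ ≤ _ := by gcongr; exact hF x
    _ = B ^ (r.toReal - p.toReal) * ∫⁻ x, F x ^ p.toReal ∂μ :=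
        lintegral_const_mul' _ _ (ENNReal.rpow_ne_top_of_nonneg (sub_nonneg.2 hPR) hB)
    _ ≤ B ^ (r.toReal - p.toReal) * B ^ p.toReal := by gcongr
    _ = B ^ r.toReal := by
        rw [← ENNReal.rpow_add_of_nonneg _ _ (sub_nonneg.2 hPR) hP0.le]; ring_nf

/-- A Young-type inequality. The uniform bound comes from Hölder on the finite measure `μ` together
with `μ ≤ volume`; the `L^p` bound comes from Minkowski and translation invariance. Interpolating
between them reaches every `r ≥ p`. -/
theorem exists_eLpNorm_lintegral_translate_le (μ : Measure ℝ) [IsFiniteMeasure μ]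
    (hμ : μ ≤ volume) {p r : ℝ≥0∞} (hp : 1 ≤ p) (hpr : p ≤ r) :
    ∃ C : ℝ≥0∞, C ≠ ∞ ∧ ∀ g : ℝ → ℝ≥0∞, Measurable g →
      eLpNorm (fun t => ∫⁻ s, g (t + s) ∂μ) r volume ≤ C * eLpNorm g p volume := by
  have hexp : 0 ≤ 1 / (1 : ℝ≥0∞).toReal - 1 / p.toReal := by
    rcases eq_or_ne p ∞ with rfl | hpt
    · simp
    · have : 1 ≤ p.toReal := by simpa using ENNReal.toReal_mono hpt hp
      have : 1 / p.toReal ≤ 1 := (div_le_one (by linarith)).2 this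
      simpa using this
  have htr : ∀ (g : ℝ → ℝ≥0∞), Measurable g → ∀ s : ℝ,
      eLpNorm (fun t => g (t + s)) p volume = eLpNorm g p volume := fun g hg s =>
    eLpNorm_comp_measurePreserving hg.aestronglyMeasurable (measurePreserving_add_right volume s)
  have htl : ∀ (g : ℝ → ℝ≥0∞), Measurable g → ∀ t : ℝ,
      eLpNorm (fun s => g (t + s)) p volume = eLpNorm g p volume := fun g hg t =>
    eLpNorm_comp_measurePreserving hg.aestronglyMeasurable (measurePreserving_add_left volume t)
  -- The first entry is the Hölder constant of the uniform bound, the second the Minkowski constant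
  -- of the `L^p` bound.
  refine ⟨max (μ Set.univ ^ (1 / (1 : ℝ≥0∞).toReal - 1 / p.toReal)) (μ Set.univ), ?_,
    fun g hg => eLpNorm_le_of_le_of_eLpNorm_le hp hpr (fun t => ?_) ?_⟩
  · exact (max_lt (ENNReal.rpow_lt_top_of_nonneg hexp (measure_ne_top _ _))
      (measure_lt_top _ _)).ne
  · have h := eLpNorm_le_eLpNorm_mul_rpow_measure_univ hp (μ := μ) (f := fun s => g (t + s))
      (hg.comp (measurable_const_add t)).aestronglyMeasurable
    rw [eLpNorm_one_eq_lintegral_enorm] at h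
    simp only [enorm_eq_self] at h
    refine h.trans ?_
    rw [mul_comm]
    gcongr
    · exact le_max_left _ _
    · exact (eLpNorm_mono_measure _ hμ).trans (htl g hg t).le
  · refine (eLpNorm_lintegral_le volume μ hp (Q := fun t s => g (t + s))
      (hg.comp (measurable_fst.add measurable_snd))).trans ?_
    simp_rw [htr g hg, lintegral_const]
    rw [mul_comm]
    gcongr
    exact le_max_right _ _

theorem snoc_add_snoc {n : ℕ} (x u : Fin n → ℝ) (t s : ℝ) :
    (Fin.snoc (α := fun _ => ℝ) x t + Fin.snoc (α := fun _ => ℝ) u s : Fin (n + 1) → ℝ)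
      = Fin.snoc (α := fun _ => ℝ) (x + u) (t + s) := by
  ext i
  refine Fin.lastCases ?_ (fun j => ?_) i <;> simp

/-- The product structure of the measure separates the shift of the last variable. Minkowski takes
the integral over that shift out of the inner norm, the induction hypothesis treats the remaining
shifts, and the one-variable bound treats the outer norm. The constants multiply. -/
theorem exists_iteratedLpNorm_lintegral_translate_le (μ : Measure ℝ) [IsFiniteMeasure μ]
    (hμ : μ ≤ volume) {n : ℕ} {p r : Fin n → ℝ≥0∞} (hp : ∀ i, 1 ≤ p i) (hpr : ∀ i, p i ≤ r i) :
    ∃ C : ℝ≥0∞, C ≠ ∞ ∧ ∀ H : (Fin n → ℝ) → ℝ≥0∞, Measurable H →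
      iteratedLpNorm n r (fun x => ∫⁻ u, H (x + u) ∂(Measure.pi fun _ => μ))
        ≤ C * iteratedLpNorm n p H := by
  induction n with
  | zero =>
    refine ⟨1, ENNReal.one_ne_top, fun H _ => ?_⟩
    simp only [iteratedLpNorm, one_mul]
    -- The empty product measure is a Dirac mass, so nothing is averaged and the constant `1`
    -- suffices.
    rw [Measure.pi_of_empty, lintegral_dirac]
    exact (congrArg H (Subsingleton.elim _ _)).le
  | succ n ih =>
    obtain ⟨C, hC, hC'⟩ := ih (p := fun i => p i.castSucc) (r := fun i => r i.castSucc)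
      (fun i => hp _) (fun i => hpr _)
    obtain ⟨D, hD, hD'⟩ := exists_eLpNorm_lintegral_translate_le μ hμ (hp (Fin.last n))
      (hpr (Fin.last n))
    refine ⟨C * D, ENNReal.mul_ne_top hC hD, fun H hH => ?_⟩
    set g : ℝ → ℝ≥0∞ := fun t => iteratedLpNorm n (fun i => p i.castSucc)
      (fun x => H (Fin.snoc (α := fun _ => ℝ) x t)) with hg
    have hHt : ∀ t, Measurable fun x : Fin n → ℝ => H (Fin.snoc (α := fun _ => ℝ) x t) := fun t =>
      hH.comp (measurable_snoc.comp measurable_prodMk_right)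
    have hgm : Measurable g := measurable_iteratedLpNorm _
      (Q := fun t x => H (Fin.snoc (α := fun _ => ℝ) x t))
      (hH.comp (measurable_snoc.comp measurable_swap))
    have hsplit : ∀ (x : Fin n → ℝ) (t : ℝ),
        ∫⁻ u, H (Fin.snoc (α := fun _ => ℝ) x t + u) ∂(Measure.pi fun _ => μ)
          = ∫⁻ s, ∫⁻ u, H (Fin.snoc (α := fun _ => ℝ) (x + u) (t + s))
              ∂(Measure.pi fun _ : Fin n => μ) ∂μ := by
      intro x t
      have h1 := (measurePreserving_piFinSuccAbove (α := fun _ : Fin (n + 1) => ℝ)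
        (fun _ => μ) (Fin.last n)).symm
      rw [← h1.lintegral_comp (f := fun u => H (Fin.snoc (α := fun _ => ℝ) x t + u))
        (hH.comp (measurable_const_add _)), lintegral_prod]
      · refine lintegral_congr fun s => lintegral_congr fun u => ?_
        rw [← snoc_add_snoc]
        simp [MeasurableEquiv.piFinSuccAbove, Fin.insertNthEquiv, Fin.insertNth_last']
      · exact (hH.comp ((measurable_const_add _).comp (MeasurableEquiv.measurable _))).aemeasurable
    have hmeas : ∀ t, Measurable (Function.uncurry fun (x : Fin n → ℝ) (s : ℝ) =>
        ∫⁻ u, H (Fin.snoc (α := fun _ => ℝ) (x + u) (t + s)) ∂(Measure.pi fun _ : Fin n => μ)) := by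
      intro t
      refine Measurable.lintegral_prod_right' (f := fun z : ((Fin n → ℝ) × ℝ) × (Fin n → ℝ) =>
        H (Fin.snoc (α := fun _ => ℝ) (z.1.1 + z.2) (t + z.1.2))) ?_
      exact hH.comp (measurable_snoc.comp
        (((measurable_fst.comp measurable_fst).add measurable_snd).prodMk
          (measurable_const.add (measurable_snd.comp measurable_fst))))
    have hle : ∀ t, iteratedLpNorm n (fun i => r i.castSucc) (fun x =>
        ∫⁻ u, H (Fin.snoc (α := fun _ => ℝ) x t + u) ∂(Measure.pi fun _ => μ))
          ≤ C * ∫⁻ s, g (t + s) ∂μ := by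
      intro t
      simp_rw [hsplit]
      refine (iteratedLpNorm_lintegral_le (fun i => (hp _).trans (hpr _)) μ (hmeas t)).trans ?_
      rw [← lintegral_const_mul (f := fun s => g (t + s)) _ (hgm.comp (measurable_const_add t))]
      exact lintegral_mono fun s => hC' _ (hHt (t + s))
    lift C to NNReal using hC
    refine (eLpNorm_le_nnreal_smul_eLpNorm_of_ae_le_mul' (c := C)
      (g := fun t => ∫⁻ s, g (t + s) ∂μ) (ae_of_all _ fun t => ?_) _).trans ?_
    · simpa only [enorm_eq_self] using hle t
    · rw [ENNReal.smul_def, smul_eq_mul, mul_assoc]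
      gcongr
      exact hD' g hgm

/-! ### Tensor product densities -/

theorem lintegral_pi_prod_eq_prod {n : ℕ} (ν : Fin n → Measure ℝ) [∀ i, SigmaFinite (ν i)]
    {k : ℝ → ℝ≥0∞} (hk : Measurable k) :
    ∫⁻ u, ∏ i, k (u i) ∂(Measure.pi ν) = ∏ i, ∫⁻ s, k s ∂(ν i) := by
  induction n with
  | zero => simp
  | succ n ih =>
    have h1 := (measurePreserving_piFinSuccAbove (α := fun _ : Fin (n + 1) => ℝ) ν 0).symm
    have hm : ∀ n : ℕ, Measurable fun u : Fin n → ℝ => ∏ i, k (u i) := fun n =>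
      Finset.measurable_prod _ fun i _ => hk.comp (measurable_pi_apply i)
    rw [← h1.lintegral_comp (hm _)]
    have h2 : ∀ z : ℝ × (Fin n → ℝ), ∏ i, k
        ((MeasurableEquiv.piFinSuccAbove (fun _ : Fin (n + 1) => ℝ) 0).symm z i)
          = k z.1 * ∏ i, k (z.2 i) := by
      intro z
      rw [Fin.prod_univ_succ]
      simp [MeasurableEquiv.piFinSuccAbove, Fin.insertNthEquiv]
    simp_rw [h2]
    rw [lintegral_prod_mul hk.aemeasurable (hm n).aemeasurable, ih, Fin.prod_univ_succ]
    simp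

theorem pi_withDensity {n : ℕ} {k : ℝ → ℝ≥0∞} (hk : Measurable k)
    [IsFiniteMeasure ((volume : Measure ℝ).withDensity k)] :
    (Measure.pi fun _ : Fin n => (volume : Measure ℝ).withDensity k)
      = (volume : Measure (Fin n → ℝ)).withDensity fun u => ∏ i, k (u i) := by
  refine Measure.pi_eq fun s hs => ?_
  rw [withDensity_apply _ (MeasurableSet.univ_pi hs), volume_pi, Measure.restrict_pi_pi,
    lintegral_pi_prod_eq_prod _ hk]
  simp_rw [withDensity_apply _ (hs _)]

/-! ### Continuous functionals and integrals of Schwartz functions -/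

/-- The bound makes `f` vanish on the kernel of `J`, so `f` descends to a bounded functional on the
range, which Hahn–Banach extends. -/
theorem exists_continuousLinearMap_comp_eq {V B : Type*} [AddCommGroup V] [Module ℂ V]
    [NormedAddCommGroup B] [NormedSpace ℂ B] (J : V →ₗ[ℂ] B) (f : V →ₗ[ℂ] ℂ) (C : ℝ)
    (hf : ∀ v, ‖f v‖ ≤ C * ‖J v‖) : ∃ F : B →L[ℂ] ℂ, ∀ v, F (J v) = f v := by
  have hker : LinearMap.ker J ≤ LinearMap.ker f := fun v hv => by
    have h0 : J v = 0 := hv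
    have := hf v
    rw [h0, norm_zero, mul_zero] at this
    exact norm_le_zero_iff.1 this
  set f' : LinearMap.range J →ₗ[ℂ] ℂ :=
    ((LinearMap.ker J).liftQ f hker) ∘ₗ J.quotKerEquivRange.symm.toLinearMap with hf'
  have hf'J : ∀ v, f' ⟨J v, LinearMap.mem_range_self J v⟩ = f v := fun v => by
    have : J.quotKerEquivRange.symm ⟨J v, LinearMap.mem_range_self J v⟩
        = (LinearMap.ker J).mkQ v := J.quotKerEquivRange_symm_apply_image v _
    simp [hf', this]
  have hb : ∀ y : LinearMap.range J, ‖f' y‖ ≤ C * ‖y‖ := by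
    rintro ⟨_, v, rfl⟩
    rw [hf'J v]
    exact hf v
  obtain ⟨F, hF, -⟩ := exists_extension_norm_eq (LinearMap.range J) (f'.mkContinuous C hb)
  exact ⟨F, fun v => (hF ⟨J v, LinearMap.mem_range_self J v⟩).trans (hf'J v)⟩

/-- A substitute for a Bochner integral in `V`, which carries no norm: `f` is controlled by finitely
many norms, so it factors through a finite product of Banach spaces, where the integral exists and
commutes with functionals. The separating families `T` reduce the identity for `g` to a pointwise
one. -/
theorem apply_eq_integral_of_bound {V ι Z : Type*} [AddCommGroup V] [Module ℂ V] [Fintype ι]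
    {B : ι → Type*} [∀ i, NormedAddCommGroup (B i)] [∀ i, NormedSpace ℂ (B i)]
    [∀ i, CompleteSpace (B i)] (J : ∀ i, V →ₗ[ℂ] B i) (f : V →ₗ[ℂ] ℂ) {C : ℝ}
    (hf : ∀ v, ‖f v‖ ≤ C * ‖fun i => J i v‖) [TopologicalSpace Z] [SecondCountableTopology Z]
    [MeasurableSpace Z] [OpensMeasurableSpace Z] {μ : Measure Z} {h : Z → V}
    (hc : ∀ i, Continuous fun w => J i (h w)) {b : ι → Z → ℝ} (hb : ∀ i, Integrable (b i) μ)
    (hJb : ∀ i w, ‖J i (h w)‖ ≤ b i w) {g : V}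
    {κ : Type*} {D : ι → Type*} [∀ i, NormedAddCommGroup (D i)] [∀ i, NormedSpace ℂ (D i)]
    [∀ i, CompleteSpace (D i)] (T : ∀ i, κ → B i →L[ℂ] D i)
    (hT : ∀ i x y, (∀ t, T i t x = T i t y) → x = y)
    (hg : ∀ i t, T i t (J i g) = ∫ w, T i t (J i (h w)) ∂μ) : f g = ∫ w, f (h w) ∂μ := by
  obtain ⟨F, hF⟩ := exists_continuousLinearMap_comp_eq (LinearMap.pi J) f C hf
  have hint : ∀ i, Integrable (fun w => J i (h w)) μ := fun i =>
    (hb i).mono' (hc i).aestronglyMeasurable (ae_of_all _ (hJb i))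
  have hJint : Integrable (fun w => LinearMap.pi J (h w)) μ := Integrable.of_eval hint
  have hJg : LinearMap.pi J g = ∫ w, LinearMap.pi J (h w) ∂μ := by
    funext i
    refine (hT i _ _ fun t => ?_ : J i g = ∫ w, J i (h w) ∂μ).trans
      ((ContinuousLinearMap.proj (R := ℂ) (φ := B) i).integral_comp_comm hJint)
    rw [hg, (T i t).integral_comp_comm (hint i)]
  rw [← hF g, hJg, ← F.integral_comp_comm hJint]
  simp_rw [hF]

section BochnerIntegral

variable {E : Type*} [NormedAddCommGroup E] [NormedSpace ℝ E]

/-- The bounded continuous function `‖·‖ ^ k • D^n g`, for a Schwartz function `g`. -/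
noncomputable def weightedDeriv (k n : ℕ) (g : 𝓢(E, ℂ)) :
    BoundedContinuousFunction E (ContinuousMultilinearMap ℝ (fun _ : Fin n => E) ℂ) :=
  BoundedContinuousFunction.ofNormedAddCommGroup
    (fun t => ‖t‖ ^ k • iteratedFDeriv ℝ n g t)
    ((continuous_norm.pow k).smul ((g.smooth n).continuous_iteratedFDeriv le_rfl))
    (SchwartzMap.seminorm ℂ k n g)
    (fun t => by
      rw [norm_smul, norm_pow, norm_norm]; exact SchwartzMap.le_seminorm ℂ k n g t)

theorem norm_weightedDeriv (k n : ℕ) (g : 𝓢(E, ℂ)) :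
    ‖weightedDeriv k n g‖ = SchwartzMap.seminorm ℂ k n g := by
  refine le_antisymm ?_ ?_
  · exact BoundedContinuousFunction.norm_ofNormedAddCommGroup_le _ (apply_nonneg _ _) _
  · refine SchwartzMap.seminorm_le_bound ℂ k n g (norm_nonneg (weightedDeriv k n g)) fun t => ?_
    have h1 := (weightedDeriv k n g).norm_coe_le_norm t
    have h2 : weightedDeriv k n g t = ‖t‖ ^ k • iteratedFDeriv ℝ n g t := rfl
    rwa [h2, norm_smul, norm_pow, norm_norm] at h1

/-- The map `g ↦ ‖·‖ ^ k • D^n g` from Schwartz functions to bounded continuous functions. -/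
noncomputable def weightedDerivCLM (k n : ℕ) : 𝓢(E, ℂ) →L[ℂ]
    (BoundedContinuousFunction E (ContinuousMultilinearMap ℝ (fun _ : Fin n => E) ℂ)) :=
  SchwartzMap.mkCLMtoNormedSpace (𝕜 := ℂ) (𝕜' := ℂ) (σ := RingHom.id ℂ) (D := E) (E := ℂ)
    (weightedDeriv k n)
    (fun f g => by
      ext1 t
      have : iteratedFDeriv ℝ n (f + g : 𝓢(E, ℂ)) t
          = iteratedFDeriv ℝ n f t + iteratedFDeriv ℝ n g t :=
        iteratedFDeriv_add_apply (f.smooth n).contDiffAt (g.smooth n).contDiffAt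
      change ‖t‖ ^ k • iteratedFDeriv ℝ n (f + g : 𝓢(E, ℂ)) t
        = ‖t‖ ^ k • iteratedFDeriv ℝ n f t + ‖t‖ ^ k • iteratedFDeriv ℝ n g t
      rw [this, smul_add])
    (fun a f => by
      ext1 t
      have : iteratedFDeriv ℝ n (a • f : 𝓢(E, ℂ)) t = a • iteratedFDeriv ℝ n f t :=
        iteratedFDeriv_const_smul_apply (f.smooth n).contDiffAt
      change ‖t‖ ^ k • iteratedFDeriv ℝ n (a • f : 𝓢(E, ℂ)) t
        = a • ‖t‖ ^ k • iteratedFDeriv ℝ n f t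
      rw [this, smul_comm])
    ⟨{(k, n)}, 1, zero_le_one, fun g => by simp [norm_weightedDeriv]⟩

theorem weightedDerivCLM_apply (k n : ℕ) (g : 𝓢(E, ℂ)) (t : E) :
    weightedDerivCLM k n g t = ‖t‖ ^ k • iteratedFDeriv ℝ n g t := rfl

theorem norm_weightedDerivCLM (k n : ℕ) (g : 𝓢(E, ℂ)) :
    ‖weightedDerivCLM k n g‖ = SchwartzMap.seminorm ℂ k n g :=
  norm_weightedDeriv k n g

variable {Z : Type*} [TopologicalSpace Z]

theorem continuous_iteratedFDeriv_apply {h : Z → 𝓢(E, ℂ)} (hc : Continuous h) (n : ℕ) (t : E) :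
    Continuous fun w => iteratedFDeriv ℝ n (h w) t := by
  have h1 : Continuous fun w => weightedDerivCLM 0 n (h w) t :=
    (BoundedContinuousFunction.evalCLM ℂ t).continuous.comp
      ((weightedDerivCLM 0 n).continuous.comp hc)
  simpa [weightedDerivCLM_apply] using h1

variable [SecondCountableTopology Z] [MeasurableSpace Z] [OpensMeasurableSpace Z]

theorem iteratedFDeriv_integral_apply (μ : Measure Z) {h : Z → 𝓢(E, ℂ)} (hc : Continuous h)
    (hint : ∀ k n, Integrable (fun w => SchwartzMap.seminorm ℂ k n (h w)) μ) (n : ℕ) :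
    iteratedFDeriv ℝ n (fun t => ∫ w, h w t ∂μ)
      = fun t => ∫ w, iteratedFDeriv ℝ n (h w) t ∂μ := by
  have hI : ∀ n t, Integrable (fun w => iteratedFDeriv ℝ n (h w) t) μ := fun n t =>
    (hint 0 n).mono' (continuous_iteratedFDeriv_apply hc n t).aestronglyMeasurable
      (ae_of_all _ fun w => SchwartzMap.norm_iteratedFDeriv_le_seminorm ℂ _ _ _)
  induction n with
  | zero =>
    funext t
    simp only [iteratedFDeriv_zero_eq_comp, Function.comp]
    exact ((continuousMultilinearCurryFin0 ℝ E ℂ).symm.toContinuousLinearEquiv.integral_comp_comm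
      _).symm
  | succ n ih =>
    funext t
    set e := continuousMultilinearCurryLeftEquiv ℝ (fun _ : Fin (n + 1) => E) ℂ with he
    have hfd : ∀ w t, fderiv ℝ (iteratedFDeriv ℝ n (h w)) t
        = e (iteratedFDeriv ℝ (n + 1) (h w) t) := fun w t => by
      rw [iteratedFDeriv_succ_eq_comp_left]
      simp [he]
    have hd : HasFDerivAt (fun t => ∫ w, iteratedFDeriv ℝ n (h w) t ∂μ)
        -- Differentiation under the integral sign; the seminorm of order `n + 1` without polynomial
        -- weight dominates the derivative uniformly in `t`.
        (∫ w, fderiv ℝ (iteratedFDeriv ℝ n (h w)) t ∂μ) t := by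
      refine hasFDerivAt_integral_of_dominated_of_fderiv_le (s := Set.univ) (𝕜 := ℝ)
        (F := fun t w => iteratedFDeriv ℝ n (h w) t)
        (F' := fun t w => fderiv ℝ (iteratedFDeriv ℝ n (h w)) t)
        (bound := fun w => SchwartzMap.seminorm ℂ 0 (n + 1) (h w))
        Filter.univ_mem (.of_forall fun t => (hI n t).aestronglyMeasurable) (hI n t) ?_ ?_
        (hint 0 (n + 1)) ?_
      · simp_rw [hfd]
        exact (e.continuous.comp
          (continuous_iteratedFDeriv_apply hc (n + 1) t)).aestronglyMeasurable
      · refine ae_of_all _ fun w t _ => ?_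
        rw [norm_fderiv_iteratedFDeriv]
        exact SchwartzMap.norm_iteratedFDeriv_le_seminorm ℂ _ _ _
      · refine ae_of_all _ fun w t _ => ?_
        exact (((h w).smooth ⊤).differentiable_iteratedFDeriv
          (by exact_mod_cast WithTop.coe_lt_top n) t).hasFDerivAt
    rw [iteratedFDeriv_succ_eq_comp_left, Function.comp_apply, ih, hd.fderiv]
    simp_rw [hfd]
    have h1 : ∫ w, e (iteratedFDeriv ℝ (n + 1) (h w) t) ∂μ
        = e (∫ w, iteratedFDeriv ℝ (n + 1) (h w) t ∂μ) := by
      let L : (E [×(n + 1)]→L[ℝ] ℂ) →L[ℝ] E →L[ℝ] E [×n]→L[ℝ] ℂ :=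
        e.toContinuousLinearEquiv.toContinuousLinearMap
      exact ContinuousLinearMap.integral_comp_comm (E := E [×(n + 1)]→L[ℝ] ℂ)
        (Fₗ := E →L[ℝ] E [×n]→L[ℝ] ℂ) (𝕜 := ℝ) L (hI (n + 1) t)
    rw [h1, LinearIsometryEquiv.symm_apply_apply]

/-- Continuity bounds `f` by finitely many Schwartz seminorms, and each of these is the sup norm of
a weighted derivative. Point evaluations separate the bounded continuous functions involved. -/
theorem apply_eq_integral_of_eq_integral (μ : Measure Z) {h : Z → 𝓢(E, ℂ)} (hc : Continuous h)
    (hint : ∀ k n, Integrable (fun w => SchwartzMap.seminorm ℂ k n (h w)) μ) {g : 𝓢(E, ℂ)}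
    (hg : ∀ t, g t = ∫ w, h w t ∂μ) (f : 𝓢(E, ℂ) →L[ℂ] ℂ) :
    f g = ∫ w, f (h w) ∂μ := by
  obtain ⟨s, C, -, hC⟩ := Seminorm.bound_of_continuous (schwartz_withSeminorms ℂ E ℂ)
    ((normSeminorm ℂ ℂ).comp f.toLinearMap) (continuous_norm.comp f.continuous)
  refine apply_eq_integral_of_bound (ι := s) (B := fun i => BoundedContinuousFunction E
      (ContinuousMultilinearMap ℝ (fun _ : Fin i.1.2 => E) ℂ))
    (fun i => (weightedDerivCLM i.1.1 i.1.2).toLinearMap) f.toLinearMap (C := C)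
    (fun v => ?_) (fun i => (weightedDerivCLM i.1.1 i.1.2).continuous.comp hc)
    (fun i => hint i.1.1 i.1.2) (fun i w => (norm_weightedDerivCLM i.1.1 i.1.2 (h w)).le)
    (fun i t => BoundedContinuousFunction.evalCLM ℂ t)
    (fun i x y hxy => BoundedContinuousFunction.ext hxy) (fun i t => ?_)
  · refine (hC v).trans ?_
    refine mul_le_mul_of_nonneg_left ?_ C.2
    refine Seminorm.finset_sup_apply_le (norm_nonneg _) fun i hi => ?_
    refine (norm_weightedDerivCLM i.1 i.2 v).symm.le.trans ?_
    exact norm_le_pi_norm (fun i : s => weightedDerivCLM i.1.1 i.1.2 v) ⟨i, hi⟩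
  · change ‖t‖ ^ i.1.1 • iteratedFDeriv ℝ i.1.2 g t
      = ∫ w, ‖t‖ ^ i.1.1 • iteratedFDeriv ℝ i.1.2 (h w) t ∂μ
    rw [integral_smul, show (g : E → ℂ) = fun t => ∫ w, h w t ∂μ from funext hg,
      iteratedFDeriv_integral_apply μ hc hint]

end BochnerIntegral

/-! ### Translations on the Schwartz space -/

section Translation

variable {E : Type*} [NormedAddCommGroup E] [NormedSpace ℝ E]

theorem norm_pow_mul_iteratedFDeriv_le (h : 𝓢(E, ℂ)) (k n : ℕ) (y : E) :
    (1 + ‖y‖) ^ k * ‖iteratedFDeriv ℝ n h y‖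
      ≤ 2 ^ k * (SchwartzMap.seminorm ℂ 0 n h + SchwartzMap.seminorm ℂ k n h) := by
  have h1 : (1 + ‖y‖) ^ k ≤ 2 ^ k * (1 + ‖y‖ ^ k) := by
    refine (add_pow_le zero_le_one (norm_nonneg y) k).trans ?_
    rw [one_pow]
    gcongr
    · norm_num
    · omega
  calc _ ≤ 2 ^ k * (1 + ‖y‖ ^ k) * ‖iteratedFDeriv ℝ n h y‖ := by gcongr
    _ = 2 ^ k * (‖iteratedFDeriv ℝ n h y‖ + ‖y‖ ^ k * ‖iteratedFDeriv ℝ n h y‖) := by ring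
    _ ≤ _ := by
      gcongr
      · exact SchwartzMap.norm_iteratedFDeriv_le_seminorm ℂ _ _ _
      · exact SchwartzMap.le_seminorm ℂ k n h y

theorem iteratedFDeriv_compSubConstCLM (h : 𝓢(E, ℂ)) (x t : E) (n : ℕ) :
    iteratedFDeriv ℝ n (SchwartzMap.compSubConstCLM ℂ x h) t = iteratedFDeriv ℝ n h (t - x) :=
  iteratedFDeriv_comp_sub n x t

theorem seminorm_compSubConstCLM_le (h : 𝓢(E, ℂ)) (x : E) (k n : ℕ) :
    SchwartzMap.seminorm ℂ k n (SchwartzMap.compSubConstCLM ℂ x h) ≤ (1 + ‖x‖) ^ k *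
      (2 ^ k * (SchwartzMap.seminorm ℂ 0 n h + SchwartzMap.seminorm ℂ k n h)) := by
  refine SchwartzMap.seminorm_le_bound ℂ k n _ (by positivity) fun t => ?_
  rw [iteratedFDeriv_compSubConstCLM]
  have h1 : ‖t‖ ≤ (1 + ‖x‖) * (1 + ‖t - x‖) := by
    have : ‖t‖ ≤ ‖t - x‖ + ‖x‖ := by simpa using norm_add_le (t - x) x
    nlinarith [norm_nonneg x, norm_nonneg (t - x), mul_nonneg (norm_nonneg x) (norm_nonneg (t - x))]
  calc _ ≤ ((1 + ‖x‖) * (1 + ‖t - x‖)) ^ k * ‖iteratedFDeriv ℝ n h (t - x)‖ := by gcongr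
    _ = (1 + ‖x‖) ^ k * ((1 + ‖t - x‖) ^ k * ‖iteratedFDeriv ℝ n h (t - x)‖) := by
        rw [mul_pow, mul_assoc]
    _ ≤ _ := mul_le_mul_of_nonneg_left (norm_pow_mul_iteratedFDeriv_le h k n (t - x)) (by positivity)

theorem seminorm_compSubConstCLM_sub_le (h : 𝓢(E, ℂ)) {x : E} (hx : ‖x‖ ≤ 1) (k n : ℕ) :
    SchwartzMap.seminorm ℂ k n (SchwartzMap.compSubConstCLM ℂ x h - h) ≤
      2 ^ k * (SchwartzMap.seminorm ℂ 0 (n + 1) h + SchwartzMap.seminorm ℂ k (n + 1) h) * ‖x‖ := by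
  refine SchwartzMap.seminorm_le_bound ℂ k n _ (by positivity) fun t => ?_
  have h1 : iteratedFDeriv ℝ n (SchwartzMap.compSubConstCLM ℂ x h - h : 𝓢(E, ℂ)) t
      = iteratedFDeriv ℝ n h (t - x) - iteratedFDeriv ℝ n h t := by
    rw [← iteratedFDeriv_compSubConstCLM]
    exact iteratedFDeriv_sub_apply ((SchwartzMap.compSubConstCLM ℂ x h).smooth n).contDiffAt
      (h.smooth n).contDiffAt
  have hdiff : Differentiable ℝ (iteratedFDeriv ℝ n h) :=
    (h.smooth ⊤).differentiable_iteratedFDeriv (by exact_mod_cast WithTop.coe_lt_top n)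
  -- Mean value inequality on the unit ball about `t`. The weight is frozen at `t`, so only the
  -- Schwartz function is differentiated; on this ball `‖t‖ ≤ 1 + ‖y‖`.
  have h2 := (convex_closedBall t 1).norm_image_sub_le_of_norm_fderiv_le (𝕜 := ℝ)
    (f := fun y => ‖t‖ ^ k • iteratedFDeriv ℝ n h y)
    (C := 2 ^ k * (SchwartzMap.seminorm ℂ 0 (n + 1) h + SchwartzMap.seminorm ℂ k (n + 1) h))
    (fun y _ => (hdiff y).const_smul (‖t‖ ^ k)) (fun y hy => ?_)
    (Metric.mem_closedBall_self zero_le_one) (y := t - x) (by simpa using hx)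
  · rw [h1]
    rwa [← smul_sub, norm_smul, norm_pow, norm_norm, sub_sub_cancel_left, norm_neg] at h2
  · rw [fderiv_fun_const_smul (hdiff y), norm_smul, norm_pow, norm_norm,
      norm_fderiv_iteratedFDeriv]
    have hy' : ‖t‖ ≤ 1 + ‖y‖ := by
      have h3 : ‖t‖ ≤ ‖t - y‖ + ‖y‖ := by simpa using norm_add_le (t - y) y
      rw [mem_closedBall_iff_norm'] at hy
      linarith
    calc _ ≤ (1 + ‖y‖) ^ k * ‖iteratedFDeriv ℝ (n + 1) h y‖ := by gcongr
      _ ≤ _ := norm_pow_mul_iteratedFDeriv_le h k (n + 1) y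

theorem tendsto_compSubConstCLM_zero (h : 𝓢(E, ℂ)) :
    Filter.Tendsto (fun x => SchwartzMap.compSubConstCLM ℂ x h) (nhds 0) (nhds h) := by
  refine ((schwartz_withSeminorms ℂ E ℂ).tendsto_nhds _ _).2 fun i ε hε => ?_
  have h1 : Filter.Tendsto (fun x : E => 2 ^ i.1 * (SchwartzMap.seminorm ℂ 0 (i.2 + 1) h
      + SchwartzMap.seminorm ℂ i.1 (i.2 + 1) h) * ‖x‖) (nhds 0) (nhds 0) := by
    have : Continuous fun x : E => 2 ^ i.1 * (SchwartzMap.seminorm ℂ 0 (i.2 + 1) h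
      + SchwartzMap.seminorm ℂ i.1 (i.2 + 1) h) * ‖x‖ := by fun_prop
    simpa using this.tendsto 0
  filter_upwards [h1.eventually_lt_const hε, Metric.closedBall_mem_nhds (0 : E) one_pos]
    with x hx hx1
  exact (seminorm_compSubConstCLM_sub_le h (by simpa using hx1) i.1 i.2).trans_lt hx

theorem continuous_seminorm (k n : ℕ) : Continuous (SchwartzMap.seminorm ℂ k n : 𝓢(E, ℂ) → ℝ) :=
  (schwartz_withSeminorms ℂ E ℂ).continuous_seminorm (k, n)

/-- Allowing every continuous seminorm, and not only the defining ones, makes the bound stable under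
composition with the Fourier transform, as modulations require. -/
theorem exists_seminorm_compSubConstCLM_le (q : Seminorm ℂ 𝓢(E, ℂ)) (hq : Continuous q) :
    ∃ (M : ℕ) (q' : Seminorm ℂ 𝓢(E, ℂ)), Continuous q' ∧
      ∀ x h, q (SchwartzMap.compSubConstCLM ℂ x h) ≤ (1 + ‖x‖) ^ M * q' h := by
  obtain ⟨s, C, -, hC⟩ := Seminorm.bound_of_continuous (schwartz_withSeminorms ℂ E ℂ) q hq
  have key : ∃ (M : ℕ) (q' : Seminorm ℂ 𝓢(E, ℂ)), Continuous q' ∧ ∀ x h,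
      s.sup (schwartzSeminormFamily ℂ E ℂ) (SchwartzMap.compSubConstCLM ℂ x h)
        ≤ (1 + ‖x‖) ^ M * q' h := by
    clear hC
    induction s using Finset.induction_on with
    | empty => exact ⟨0, 0, continuous_const, fun x h => by simp⟩
    | insert i s _ ih =>
      obtain ⟨M, q', hq', h'⟩ := ih
      refine ⟨i.1 + M, (2 ^ i.1 : NNReal) • (SchwartzMap.seminorm ℂ 0 i.2
        + SchwartzMap.seminorm ℂ i.1 i.2) + q', ?_, fun x h => ?_⟩
      · exact (((continuous_seminorm 0 i.2).add (continuous_seminorm i.1 i.2)).const_smul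
          (2 ^ i.1 : NNReal)).add hq'
      · rw [Finset.sup_insert, Seminorm.sup_apply]
        have e1 : (1 : ℝ) ≤ (1 + ‖x‖) ^ i.1 := one_le_pow₀ (by simp)
        have e2 : (1 : ℝ) ≤ (1 + ‖x‖) ^ M := one_le_pow₀ (by simp)
        have e3 := seminorm_compSubConstCLM_le h x i.1 i.2
        have e4 := h' x h
        have e5 : ((2 ^ i.1 : NNReal) • (SchwartzMap.seminorm ℂ 0 i.2
            + SchwartzMap.seminorm ℂ i.1 i.2) + q' : Seminorm ℂ 𝓢(E, ℂ)) h = 2 ^ i.1 * (SchwartzMap.seminorm ℂ 0 i.2 h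
            + SchwartzMap.seminorm ℂ i.1 i.2 h) + q' h := by
          simp [NNReal.smul_def, mul_add]
        set a := 2 ^ i.1 * (SchwartzMap.seminorm ℂ 0 i.2 h + SchwartzMap.seminorm ℂ i.1 i.2 h)
        have ha : 0 ≤ a := by positivity
        have hb : 0 ≤ q' h := apply_nonneg _ _
        rw [e5, pow_add]
        refine max_le (e3.trans ?_) (e4.trans ?_)
        · calc (1 + ‖x‖) ^ i.1 * a = (1 + ‖x‖) ^ i.1 * 1 * (a + 0) := by ring
            _ ≤ _ := by gcongr
        · calc (1 + ‖x‖) ^ M * q' h = 1 * (1 + ‖x‖) ^ M * (0 + q' h) := by ring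
            _ ≤ _ := by gcongr
  obtain ⟨M, q', hq', h'⟩ := key
  refine ⟨M, C • q', hq'.const_smul C, fun x h => (hC _).trans ?_⟩
  calc _ ≤ (C : ℝ) * ((1 + ‖x‖) ^ M * q' h) := mul_le_mul_of_nonneg_left (h' x h) C.2
    _ = _ := by simp [NNReal.smul_def]; ring

/-- Joint continuity is needed since a time-frequency shift translates, on the Fourier side, a
function that itself varies. It follows from `T_x h - T_{x₀} h₀ = T_x (h - h₀) + T_{x₀} (T_{x - x₀}
h₀ - h₀)`, with locally bounded growth of the seminorms in the first term and continuity at the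
origin in the second. -/
theorem continuous_compSubConstCLM :
    Continuous fun z : E × 𝓢(E, ℂ) => SchwartzMap.compSubConstCLM ℂ z.1 z.2 := by
  refine continuous_iff_continuousAt.2 fun ⟨x₀, h₀⟩ => ?_
  refine ((schwartz_withSeminorms ℂ E ℂ).tendsto_nhds _ _).2 fun i ε hε => ?_
  obtain ⟨M, q, hq, hle⟩ := exists_seminorm_compSubConstCLM_le (SchwartzMap.seminorm ℂ i.1 i.2)
    (continuous_seminorm (E := E) i.1 i.2)
  have hT : Filter.Tendsto (fun z : E × 𝓢(E, ℂ) => SchwartzMap.compSubConstCLM ℂ (z.1 - x₀) h₀ - h₀)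
      (nhds (x₀, h₀)) (nhds 0) := by
    have h1 : Filter.Tendsto (fun z : E × 𝓢(E, ℂ) => z.1 - x₀) (nhds (x₀, h₀)) (nhds 0) := by
      have : Continuous fun z : E × 𝓢(E, ℂ) => z.1 - x₀ := by fun_prop
      simpa using this.tendsto (x₀, h₀)
    simpa using ((tendsto_compSubConstCLM_zero h₀).comp h1).sub_const h₀
  have hlim : Filter.Tendsto (fun z : E × 𝓢(E, ℂ) => (1 + ‖z.1‖) ^ M * q (z.2 - h₀)
      + (1 + ‖x₀‖) ^ M * q (SchwartzMap.compSubConstCLM ℂ (z.1 - x₀) h₀ - h₀))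
      (nhds (x₀, h₀)) (nhds 0) := by
    have h1 : Continuous fun z : E × 𝓢(E, ℂ) => (1 + ‖z.1‖) ^ M * q (z.2 - h₀) := by fun_prop
    have h2 := ((hq.tendsto 0).comp hT).const_mul ((1 + ‖x₀‖) ^ M)
    simpa using (h1.tendsto (x₀, h₀)).add h2
  filter_upwards [hlim.eventually_lt_const hε] with z hz
  refine lt_of_le_of_lt ?_ hz
  have hsplit : SchwartzMap.compSubConstCLM ℂ z.1 z.2 - SchwartzMap.compSubConstCLM ℂ x₀ h₀
      = SchwartzMap.compSubConstCLM ℂ z.1 (z.2 - h₀) + SchwartzMap.compSubConstCLM ℂ x₀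
        (SchwartzMap.compSubConstCLM ℂ (z.1 - x₀) h₀ - h₀) := by
    rw [map_sub, map_sub, SchwartzMap.compSubConstCLM_comp, sub_add_cancel]
    abel
  change SchwartzMap.seminorm ℂ i.1 i.2 _ ≤ _
  rw [hsplit]
  exact (map_add_le_add _ _ _).trans (add_le_add (hle _ _) (hle _ _))

end Translation

/-! ### Time-frequency shifts: continuity and polynomial growth -/

-- Conjugation by the Fourier transform carries the results on translations over to modulations.
open FourierTransform in
theorem tfModulate_eq {d : ℕ} (ξ : EuclideanSpace ℝ (Fin d))
    (g : 𝓢(EuclideanSpace ℝ (Fin d), ℂ)) :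
    tfModulate ξ g = 𝓕⁻ (SchwartzMap.compSubConstCLM ℂ ξ (𝓕 g)) := by
  have : 𝓕 (tfModulate ξ g) = SchwartzMap.compSubConstCLM ℂ ξ (𝓕 g) := by
    ext η
    rw [SchwartzMap.compSubConstCLM_apply, SchwartzMap.fourier_coe, SchwartzMap.fourier_coe,
      Real.fourier_eq', Real.fourier_eq']
    congr 1
    funext t
    rw [tfModulate_apply, smul_eq_mul, smul_eq_mul, ← mul_assoc, ← Complex.exp_add, inner_sub_right]
    congr 2
    push_cast
    ring
  rw [← this, fourierInv_fourier_eq]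

section TimeFrequencyShift

variable {d : ℕ}

/-- The time-frequency shift `M_ξ T_x` at the point `z = (x, ξ)` of `ℝ^{2d}`. -/
noncomputable def tfShift (z : Fin (d + d) → ℝ) (φ : 𝓢(EuclideanSpace ℝ (Fin d), ℂ)) :
    𝓢(EuclideanSpace ℝ (Fin d), ℂ) :=
  tfModulate (WithLp.toLp 2 fun i => z (Fin.natAdd d i))
    (tfTranslate (WithLp.toLp 2 fun i => z (Fin.castAdd d i)) φ)

theorem tfShift_apply (z : Fin (d + d) → ℝ) (φ : 𝓢(EuclideanSpace ℝ (Fin d), ℂ))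
    (t : EuclideanSpace ℝ (Fin d)) :
    tfShift z φ t = Complex.exp (2 * Real.pi * Complex.I *
      (inner ℝ t (WithLp.toLp 2 fun i => z (Fin.natAdd d i)) : ℝ)) *
      φ (t - WithLp.toLp 2 fun i => z (Fin.castAdd d i)) := by
  rw [tfShift, tfModulate_apply, tfTranslate_apply]

theorem continuous_toLp_comp {ι : Type*} [Fintype ι] {κ : Type*} (e : ι → κ) :
    Continuous fun z : κ → ℝ => (WithLp.toLp 2 fun i => z (e i) : EuclideanSpace ℝ ι) :=
  (PiLp.continuous_toLp 2 _).comp (continuous_pi fun i => continuous_apply (e i))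

theorem continuous_tfShift (φ : 𝓢(EuclideanSpace ℝ (Fin d), ℂ)) :
    Continuous fun z => tfShift z φ := by
  let F : 𝓢(EuclideanSpace ℝ (Fin d), ℂ) →L[ℂ] 𝓢(EuclideanSpace ℝ (Fin d), ℂ) :=
    FourierTransform.fourierCLM ℂ _
  let G : 𝓢(EuclideanSpace ℝ (Fin d), ℂ) →L[ℂ] 𝓢(EuclideanSpace ℝ (Fin d), ℂ) :=
    FourierTransform.fourierInvCLM ℂ _
  have h1 : Continuous fun z : Fin (d + d) → ℝ => F (SchwartzMap.compSubConstCLM ℂ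
      (WithLp.toLp 2 fun i => z (Fin.castAdd d i) : EuclideanSpace ℝ (Fin d)) φ) :=
    F.continuous.comp (continuous_compSubConstCLM.comp
      ((continuous_toLp_comp (Fin.castAdd d)).prodMk continuous_const))
  have h2 : Continuous fun z : Fin (d + d) → ℝ => G (SchwartzMap.compSubConstCLM ℂ
      (WithLp.toLp 2 fun i => z (Fin.natAdd d i)) (F (SchwartzMap.compSubConstCLM ℂ
      (WithLp.toLp 2 fun i => z (Fin.castAdd d i) : EuclideanSpace ℝ (Fin d)) φ))) :=
    G.continuous.comp (continuous_compSubConstCLM.comp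
      ((continuous_toLp_comp (Fin.natAdd d)).prodMk h1))
  exact h2.congr fun z => (tfModulate_eq _ _).symm

theorem one_add_sum_le_prod {ι : Type*} (s : Finset ι) {a : ι → ℝ} (ha : ∀ i, 0 ≤ a i) :
    1 + ∑ i ∈ s, a i ≤ ∏ i ∈ s, (1 + a i) := by
  classical
  induction s using Finset.induction_on with
  | empty => simp
  | insert i s hi ih =>
    rw [Finset.sum_insert hi, Finset.prod_insert hi]
    have h1 := Finset.sum_nonneg (s := s) fun i _ => ha i
    nlinarith [ha i, mul_nonneg (ha i) h1]

theorem one_add_norm_toLp_le {ι : Type*} [Fintype ι] (u : ι → ℝ) :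
    1 + ‖(WithLp.toLp 2 u : EuclideanSpace ℝ ι)‖ ≤ ∏ i, (1 + |u i|) := by
  have h1 : ‖(WithLp.toLp 2 u : EuclideanSpace ℝ ι)‖ ≤ ∑ i, |u i| := by
    rw [EuclideanSpace.norm_eq]
    refine Real.sqrt_le_iff.2 ⟨Finset.sum_nonneg fun i _ => abs_nonneg _, ?_⟩
    simpa using Finset.sum_sq_le_sq_sum_of_nonneg (s := Finset.univ) (f := fun i => |u i|)
      fun i _ => abs_nonneg _
  have h2 := one_add_sum_le_prod Finset.univ fun i => abs_nonneg (u i)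
  linarith

theorem one_le_prod_one_add_abs {ι : Type*} [Fintype ι] (u : ι → ℝ) :
    1 ≤ ∏ i, (1 + |u i|) :=
  (le_add_of_nonneg_right (Finset.sum_nonneg fun _ _ => abs_nonneg _)).trans
    (one_add_sum_le_prod Finset.univ fun i => abs_nonneg (u i))

theorem exists_seminorm_tfShift_le (φ : 𝓢(EuclideanSpace ℝ (Fin d), ℂ)) (k n : ℕ) :
    ∃ (M : ℕ) (C : ℝ), ∀ z, SchwartzMap.seminorm ℂ k n (tfShift z φ)
      ≤ C * (∏ i, (1 + |z i|)) ^ M := by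
  let F : 𝓢(EuclideanSpace ℝ (Fin d), ℂ) →L[ℂ] 𝓢(EuclideanSpace ℝ (Fin d), ℂ) :=
    FourierTransform.fourierCLM ℂ _
  let G : 𝓢(EuclideanSpace ℝ (Fin d), ℂ) →L[ℂ] 𝓢(EuclideanSpace ℝ (Fin d), ℂ) :=
    FourierTransform.fourierInvCLM ℂ _
  obtain ⟨M₁, q₁, hq₁, h₁⟩ := exists_seminorm_compSubConstCLM_le
    ((SchwartzMap.seminorm ℂ k n : Seminorm ℂ 𝓢(EuclideanSpace ℝ (Fin d), ℂ)).comp G.toLinearMap)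
    ((continuous_seminorm k n).comp G.continuous)
  obtain ⟨M₂, q₂, hq₂, h₂⟩ := exists_seminorm_compSubConstCLM_le (q₁.comp F.toLinearMap)
    (hq₁.comp F.continuous)
  refine ⟨M₁ + M₂, q₂ φ, fun z => ?_⟩
  set ξ : EuclideanSpace ℝ (Fin d) := WithLp.toLp 2 fun i => z (Fin.natAdd d i) with hξ
  set x : EuclideanSpace ℝ (Fin d) := WithLp.toLp 2 fun i => z (Fin.castAdd d i) with hx
  have e1 : tfShift z φ = G (SchwartzMap.compSubConstCLM ℂ ξ
      (F (SchwartzMap.compSubConstCLM ℂ x φ))) := tfModulate_eq _ _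
  have hP := Fin.prod_univ_add fun i : Fin (d + d) => 1 + |z i|
  have hξ' := one_add_norm_toLp_le fun i => z (Fin.natAdd d i)
  have hx' := one_add_norm_toLp_le fun i => z (Fin.castAdd d i)
  have hξ1 := one_le_prod_one_add_abs fun i => z (Fin.natAdd d i)
  have hx1 := one_le_prod_one_add_abs fun i => z (Fin.castAdd d i)
  have hq : 0 ≤ q₂ φ := apply_nonneg _ _
  have hξP : 1 + ‖ξ‖ ≤ ∏ i, (1 + |z i|) := by rw [hP]; nlinarith
  have hxP : 1 + ‖x‖ ≤ ∏ i, (1 + |z i|) := by rw [hP]; nlinarith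
  rw [e1]
  calc _ ≤ (1 + ‖ξ‖) ^ M₁ * q₁ (F (SchwartzMap.compSubConstCLM ℂ x φ)) := h₁ _ _
    _ ≤ (1 + ‖ξ‖) ^ M₁ * ((1 + ‖x‖) ^ M₂ * q₂ φ) :=
        mul_le_mul_of_nonneg_left (h₂ _ _) (by positivity)
    _ ≤ (∏ i, (1 + |z i|)) ^ M₁ * ((∏ i, (1 + |z i|)) ^ M₂ * q₂ φ) := by gcongr
    _ = _ := by rw [pow_add]; ring

end TimeFrequencyShift

/-! ### Decay of correlations of Schwartz functions -/

section Decay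

variable {E : Type*} [NormedAddCommGroup E] [InnerProductSpace ℝ E] [FiniteDimensional ℝ E]
  [MeasurableSpace E] [BorelSpace E]

theorem exists_one_add_norm_pow_mul_integral_le (g h : 𝓢(E, ℂ)) (N : ℕ) :
    ∃ C : ℝ, ∀ x, (1 + ‖x‖) ^ N * ∫ t, ‖g t‖ * ‖h (t - x)‖ ≤ C := by
  set S := 2 ^ N * (SchwartzMap.seminorm ℂ 0 0 h + SchwartzMap.seminorm ℂ N 0 h) with hS
  have hh : ∀ y, (1 + ‖y‖) ^ N * ‖h y‖ ≤ S := fun y => by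
    have := norm_pow_mul_iteratedFDeriv_le h N 0 y
    rwa [norm_iteratedFDeriv_zero] at this
  have hS0 : 0 ≤ S := by positivity
  have hint : Integrable (fun t => 2 ^ N * (‖g t‖ + ‖t‖ ^ N * ‖g t‖) * S) (volume : Measure E) :=
    (((g.integrable (μ := volume)).norm.add (g.integrable_pow_mul volume N)).const_mul _).mul_const _
  refine ⟨∫ t, 2 ^ N * (‖g t‖ + ‖t‖ ^ N * ‖g t‖) * S, fun x => ?_⟩
  rw [← integral_const_mul]
  refine integral_mono_of_nonneg (ae_of_all _ fun t => by positivity) hint (ae_of_all _ fun t => ?_)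
  -- The polynomial factor in `x` is shared between `g` at `t` and `h` at `t - x`.
  have h1 : 1 + ‖x‖ ≤ (1 + ‖t‖) * (1 + ‖t - x‖) := by
    have : ‖x‖ ≤ ‖t‖ + ‖t - x‖ := by
      have := norm_sub_le t (t - x); rwa [sub_sub_cancel] at this
    nlinarith [mul_nonneg (norm_nonneg t) (norm_nonneg (t - x))]
  have h2 : (1 + ‖t‖) ^ N ≤ 2 ^ N * (1 + ‖t‖ ^ N) := by
    refine (add_pow_le zero_le_one (norm_nonneg t) N).trans ?_
    rw [one_pow]
    gcongr
    · norm_num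
    · omega
  calc (1 + ‖x‖) ^ N * (‖g t‖ * ‖h (t - x)‖)
      ≤ ((1 + ‖t‖) * (1 + ‖t - x‖)) ^ N * (‖g t‖ * ‖h (t - x)‖) := by gcongr
    _ = (1 + ‖t‖) ^ N * ‖g t‖ * ((1 + ‖t - x‖) ^ N * ‖h (t - x)‖) := by rw [mul_pow]; ring
    _ ≤ 2 ^ N * (1 + ‖t‖ ^ N) * ‖g t‖ * S := by gcongr; exact hh _
    _ = _ := by ring

open FourierTransform in
theorem norm_fourier_compSubConstCLM (h : 𝓢(E, ℂ)) (x η : E) :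
    ‖𝓕 (SchwartzMap.compSubConstCLM ℂ x h) η‖ = ‖𝓕 h η‖ := by
  have h1 : 𝓕 (SchwartzMap.compSubConstCLM ℂ x h) η
      = Complex.exp (2 * Real.pi * Complex.I * (inner ℝ (-x) η : ℝ)) * 𝓕 h η := by
    rw [SchwartzMap.fourier_coe, SchwartzMap.fourier_coe, Real.fourier_eq', Real.fourier_eq',
      ← integral_const_mul, ← integral_add_right_eq_self _ x]
    congr 1
    funext t
    rw [SchwartzMap.compSubConstCLM_apply, add_sub_cancel_right, smul_eq_mul, smul_eq_mul,
      ← mul_assoc, ← Complex.exp_add, inner_add_left, inner_neg_left]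
    congr 2
    push_cast
    ring
  have h2 : ‖Complex.exp (2 * Real.pi * Complex.I * (inner ℝ (-x) η : ℝ))‖ = 1 := by
    rw [Complex.norm_exp]; simp
  rw [h1, norm_mul, h2, one_mul]

end Decay

/-! ### Rapid decay of the kernel `V_φ φ` -/

section Kernel

variable {d : ℕ}

/-- The Gabor transform `⟨φ, M_ξ T_x φ⟩` of the window `φ` with respect to itself. -/
noncomputable def gaborKernel (φ : 𝓢(EuclideanSpace ℝ (Fin d), ℂ)) (w : Fin (d + d) → ℝ) : ℂ :=
  ∫ t, conj (tfShift w φ t) * φ t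

theorem continuous_gaborKernel (φ : 𝓢(EuclideanSpace ℝ (Fin d), ℂ)) :
    Continuous (gaborKernel φ) := by
  let L : 𝓢(EuclideanSpace ℝ (Fin d), ℂ) →L[ℂ] ℂ := (SchwartzMap.integralCLM ℂ volume).comp
    (SchwartzMap.pairing (ContinuousLinearMap.mul ℂ ℂ) (schwartzConj φ))
  have h1 : Continuous fun w => conj (L (tfShift w φ)) :=
    Complex.continuous_conj.comp (L.continuous.comp (continuous_tfShift φ))
  refine h1.congr fun w => ?_
  have h2 : L (tfShift w φ) = ∫ t, conj (φ t) * tfShift w φ t := rfl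
  rw [h2, ← integral_conj, gaborKernel]
  simp [mul_comm]

theorem norm_tfShift_apply (z : Fin (d + d) → ℝ) (φ : 𝓢(EuclideanSpace ℝ (Fin d), ℂ))
    (t : EuclideanSpace ℝ (Fin d)) :
    ‖tfShift z φ t‖ = ‖φ (t - WithLp.toLp 2 fun i => z (Fin.castAdd d i))‖ := by
  rw [tfShift_apply, norm_mul, Complex.norm_exp]
  simp

theorem norm_gaborKernel_le (φ : 𝓢(EuclideanSpace ℝ (Fin d), ℂ)) (w : Fin (d + d) → ℝ) :
    ‖gaborKernel φ w‖ ≤ ∫ t, ‖φ t‖ * ‖φ (t - WithLp.toLp 2 fun i => w (Fin.castAdd d i))‖ := by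
  refine (norm_integral_le_integral_norm _).trans_eq ?_
  congr 1
  funext t
  rw [norm_mul, RCLike.norm_conj, norm_tfShift_apply, mul_comm]

-- By Parseval the frequency shift becomes a translation of the Fourier transform, so the decay of
-- correlations applies in `ξ` as well.
open FourierTransform in
theorem norm_gaborKernel_le_fourier (φ : 𝓢(EuclideanSpace ℝ (Fin d), ℂ)) (w : Fin (d + d) → ℝ) :
    ‖gaborKernel φ w‖ ≤
      ∫ η, ‖𝓕 φ η‖ * ‖𝓕 φ (η - WithLp.toLp 2 fun i => w (Fin.natAdd d i))‖ := by
  have h1 : gaborKernel φ w = ∫ η, conj (𝓕 (tfShift w φ) η) * 𝓕 φ η := by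
    have h := SchwartzMap.integral_sesq_fourier_fourier (tfShift w φ) φ (innerSL ℂ)
    simp only [innerSL_apply_apply, RCLike.inner_apply'] at h
    rw [gaborKernel]
    simpa [mul_comm] using h.symm
  rw [h1]
  refine (norm_integral_le_integral_norm _).trans_eq ?_
  congr 1
  funext η
  rw [norm_mul, RCLike.norm_conj, tfShift, tfModulate_eq, FourierTransform.fourier_fourierInv_eq,
    SchwartzMap.compSubConstCLM_apply, tfTranslate, norm_fourier_compSubConstCLM, mul_comm]

theorem prod_one_add_abs_le {n : ℕ} (u : Fin n → ℝ) :
    ∏ i, (1 + |u i|) ≤ (1 + ‖(WithLp.toLp 2 u : EuclideanSpace ℝ (Fin n))‖) ^ n := by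
  calc ∏ i, (1 + |u i|)
      ≤ ∏ _i : Fin n, (1 + ‖(WithLp.toLp 2 u : EuclideanSpace ℝ (Fin n))‖) := by
        refine Finset.prod_le_prod (fun i _ => by positivity) fun i _ => ?_
        have := PiLp.norm_apply_le (WithLp.toLp 2 u : EuclideanSpace ℝ (Fin n)) i
        simpa using this
    _ = _ := by simp

theorem exists_gaborKernel_mul_prod_le (φ : 𝓢(EuclideanSpace ℝ (Fin d), ℂ)) (m : ℕ) :
    ∃ C : ℝ, ∀ w, ‖gaborKernel φ w‖ * (∏ i, (1 + |w i|)) ^ m ≤ C := by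
  -- The factor `d` turns the norm into the product over `d` coordinates. The factor `2` is there
  -- because decay is known in `x` and in `ξ` only separately: the two are combined through `2XY ≤
  -- X² + Y²`.
  obtain ⟨C₁, h₁⟩ := exists_one_add_norm_pow_mul_integral_le φ φ (d * (2 * m))
  obtain ⟨C₂, h₂⟩ := exists_one_add_norm_pow_mul_integral_le (FourierTransform.fourier φ)
    (FourierTransform.fourier φ) (d * (2 * m))
  refine ⟨C₁ + C₂, fun w => ?_⟩
  set a := ‖gaborKernel φ w‖ with ha
  have e₁ : a * (∏ i, (1 + |w (Fin.castAdd d i)|)) ^ (2 * m) ≤ C₁ := by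
    refine le_trans ?_ (h₁ (WithLp.toLp 2 fun i => w (Fin.castAdd d i)))
    rw [mul_comm, pow_mul _ d]
    gcongr
    · exact prod_one_add_abs_le _
    · exact norm_gaborKernel_le φ w
  have e₂ : a * (∏ i, (1 + |w (Fin.natAdd d i)|)) ^ (2 * m) ≤ C₂ := by
    refine le_trans ?_ (h₂ (WithLp.toLp 2 fun i => w (Fin.natAdd d i)))
    rw [mul_comm, pow_mul _ d]
    gcongr
    · exact prod_one_add_abs_le _
    · exact norm_gaborKernel_le_fourier φ w
  rw [Fin.prod_univ_add, mul_pow]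
  rw [mul_comm 2 m, pow_mul] at e₁ e₂
  set X := (∏ i, (1 + |w (Fin.castAdd d i)|)) ^ m
  set Y := (∏ i, (1 + |w (Fin.natAdd d i)|)) ^ m
  have ha0 : 0 ≤ a := norm_nonneg _
  nlinarith [mul_nonneg ha0 (sq_nonneg (X - Y)), mul_nonneg ha0 (sq_nonneg X),
    mul_nonneg ha0 (sq_nonneg Y)]

theorem integrable_inv_one_add_abs_sq : Integrable fun s : ℝ => ((1 + |s|) ^ 2)⁻¹ := by
  have h := integrable_one_add_norm (E := ℝ) (μ := volume) (r := 2) (by simp)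
  refine h.congr (ae_of_all _ fun s => ?_)
  simp only [Real.norm_eq_abs]
  rw [Real.rpow_neg (by positivity)]
  norm_cast

theorem integrable_inv_prod_one_add_abs_sq (n : ℕ) :
    Integrable fun w : Fin n → ℝ => ((∏ i, (1 + |w i|)) ^ 2)⁻¹ := by
  have h := Integrable.fintype_prod (f := fun (_ : Fin n) (s : ℝ) => ((1 + |s|) ^ 2)⁻¹)
    (μ := fun _ => volume) fun _ => integrable_inv_one_add_abs_sq
  refine h.congr (ae_of_all _ fun w => ?_)
  simp [Finset.prod_inv_distrib, Finset.prod_pow]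

theorem integrable_gaborKernel_seminorm (φ : 𝓢(EuclideanSpace ℝ (Fin d), ℂ)) (k n : ℕ) :
    Integrable fun w => SchwartzMap.seminorm ℂ k n (gaborKernel φ w • tfShift w φ) := by
  obtain ⟨M, C, hC⟩ := exists_seminorm_tfShift_le φ k n
  -- The power `M` cancels the growth of the seminorm, and the power `2` leaves an integrable
  -- function.
  obtain ⟨D, hD⟩ := exists_gaborKernel_mul_prod_le φ (M + 2)
  refine ((integrable_inv_prod_one_add_abs_sq (d + d)).const_mul (|C| * D)).mono'
    ((continuous_seminorm k n).comp
      ((continuous_gaborKernel φ).smul (continuous_tfShift φ))).aestronglyMeasurable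
    (ae_of_all _ fun w => ?_)
  have hP : 0 < ∏ i, (1 + |w i|) := zero_lt_one.trans_le (one_le_prod_one_add_abs w)
  rw [Real.norm_of_nonneg (apply_nonneg _ _), map_smul_eq_mul, ← div_eq_mul_inv, le_div_iff₀
    (by positivity)]
  have h1 := hC w
  have h2 := hD w
  set P := ∏ i, (1 + |w i|)
  calc _ ≤ ‖gaborKernel φ w‖ * (|C| * P ^ M) * P ^ 2 := by
        gcongr
        exact h1.trans (mul_le_mul_of_nonneg_right (le_abs_self C) (by positivity))
    _ = |C| * (‖gaborKernel φ w‖ * P ^ (M + 2)) := by rw [pow_add]; ring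
    _ ≤ |C| * D := by gcongr

end Kernel

/-! ### The reproducing formula and the pointwise inequality -/

section Reproducing

variable {d : ℕ}

/-- The splitting of a point of `ℝ^{2d}` into its first and last `d` coordinates. -/
noncomputable def phaseSpaceEquiv (d : ℕ) : (Fin (d + d) → ℝ) ≃ᵐ
    EuclideanSpace ℝ (Fin d) × EuclideanSpace ℝ (Fin d) :=
  ((MeasurableEquiv.piCongrLeft (fun _ => ℝ) finSumFinEquiv).symm.trans
    (MeasurableEquiv.sumPiEquivProdPi fun _ => ℝ)).trans
    ((MeasurableEquiv.toLp 2 _).prodCongr (MeasurableEquiv.toLp 2 _))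

theorem phaseSpaceEquiv_apply (z : Fin (d + d) → ℝ) : phaseSpaceEquiv d z =
    (WithLp.toLp 2 fun i => z (Fin.castAdd d i), WithLp.toLp 2 fun i => z (Fin.natAdd d i)) := rfl

theorem measurePreserving_phaseSpaceEquiv : MeasurePreserving (phaseSpaceEquiv d) :=
  (((PiLp.volume_preserving_toLp _).prod (PiLp.volume_preserving_toLp _)).comp
    (volume_measurePreserving_sumPiEquivProdPi fun _ => ℝ)).comp
    (volume_measurePreserving_piCongrLeft (fun _ => ℝ) finSumFinEquiv).symm

/-- The product `φ · conj (T_x φ)`. -/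
noncomputable def windowProduct (φ : 𝓢(EuclideanSpace ℝ (Fin d), ℂ))
    (x : EuclideanSpace ℝ (Fin d)) : 𝓢(EuclideanSpace ℝ (Fin d), ℂ) :=
  SchwartzMap.pairing (ContinuousLinearMap.mul ℂ ℂ) φ (schwartzConj (tfTranslate x φ))

theorem windowProduct_apply (φ : 𝓢(EuclideanSpace ℝ (Fin d), ℂ))
    (x t : EuclideanSpace ℝ (Fin d)) : windowProduct φ x t = φ t * conj (φ (t - x)) := rfl

theorem conj_exp_two_pi_mul_I (r : ℝ) : conj (Complex.exp (2 * Real.pi * Complex.I * r))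
    = Complex.exp (-(2 * Real.pi * Complex.I * r)) := by
  rw [← Complex.exp_conj]
  simp [map_ofNat]

open FourierTransform in
theorem gaborKernel_eq_fourier (φ : 𝓢(EuclideanSpace ℝ (Fin d), ℂ)) (z : Fin (d + d) → ℝ) :
    gaborKernel φ z = 𝓕 (windowProduct φ (phaseSpaceEquiv d z).1) (phaseSpaceEquiv d z).2 := by
  rw [SchwartzMap.fourier_coe, Real.fourier_eq', gaborKernel]
  congr 1
  funext t
  rw [tfShift_apply, map_mul, conj_exp_two_pi_mul_I, windowProduct_apply, smul_eq_mul,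
    phaseSpaceEquiv_apply, mul_assoc, mul_comm (conj _) (φ t)]
  congr 2
  push_cast
  ring

theorem integrable_gaborKernel_mul_tfShift (φ : 𝓢(EuclideanSpace ℝ (Fin d), ℂ))
    (t : EuclideanSpace ℝ (Fin d)) : Integrable fun w => gaborKernel φ w * tfShift w φ t := by
  refine (integrable_gaborKernel_seminorm φ 0 0).mono' ?_ (ae_of_all _ fun w => ?_)
  · have h1 : Continuous fun w => tfShift w φ t :=
      ((BoundedContinuousFunction.evalCLM ℂ t).comp
        (SchwartzMap.toBoundedContinuousFunctionCLM ℂ _ ℂ)).continuous.comp (continuous_tfShift φ)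
    exact ((continuous_gaborKernel φ).mul h1).aestronglyMeasurable
  · exact SchwartzMap.norm_le_seminorm ℂ (gaborKernel φ w • tfShift w φ) t

-- For fixed `x` the kernel is the Fourier transform of `φ · conj (T_x φ)`, so by Fourier inversion
-- the `ξ`-integral yields `φ(t) |φ(t - x)|²`. Integrating in `x` leaves `‖φ‖² φ(t)`.
open FourierTransform in
theorem integral_gaborKernel_mul_tfShift (φ : 𝓢(EuclideanSpace ℝ (Fin d), ℂ))
    (t : EuclideanSpace ℝ (Fin d)) :
    ∫ w, gaborKernel φ w * tfShift w φ t = ((∫ x, ‖φ x‖ ^ 2 : ℝ) : ℂ) * φ t := by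
  set G : EuclideanSpace ℝ (Fin d) × EuclideanSpace ℝ (Fin d) → ℂ := fun y =>
    𝓕 (windowProduct φ y.1) y.2 *
      (Complex.exp (2 * Real.pi * Complex.I * (inner ℝ t y.2 : ℝ)) * φ (t - y.1)) with hG
  have hGz : ∀ w, gaborKernel φ w * tfShift w φ t = G (phaseSpaceEquiv d w) := fun w => by
    rw [gaborKernel_eq_fourier, tfShift_apply, hG, phaseSpaceEquiv_apply]
  have hGint : Integrable G := by
    rw [← measurePreserving_phaseSpaceEquiv.integrable_comp_emb
      (phaseSpaceEquiv d).measurableEmbedding]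
    exact (integrable_gaborKernel_mul_tfShift φ t).congr (ae_of_all _ hGz)
  have hinner : ∀ x, ∫ ξ, G (x, ξ) = windowProduct φ x t * φ (t - x) := fun x => by
    have h1 : 𝓕⁻ (𝓕 (windowProduct φ x)) t = windowProduct φ x t := by
      rw [fourierInv_fourier_eq]
    rw [← h1, SchwartzMap.fourierInv_coe, Real.fourierInv_eq', ← integral_mul_const]
    congr 1
    funext ξ
    simp only [hG, smul_eq_mul, real_inner_comm t ξ]
    rw [← mul_assoc, mul_comm (𝓕 (windowProduct φ x) ξ)]
    congr 3
    push_cast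
    ring
  simp_rw [hGz]
  rw [measurePreserving_phaseSpaceEquiv.integral_comp (phaseSpaceEquiv d).measurableEmbedding G,
    Measure.volume_eq_prod, integral_prod G hGint]
  simp_rw [hinner, windowProduct_apply]
  rw [← integral_sub_left_eq_self (fun x => ‖φ x‖ ^ 2) volume t, ← integral_complex_ofReal,
    ← integral_mul_const]
  congr 1
  funext x
  push_cast
  rw [← Complex.conj_mul']
  ring

theorem tfShift_tfShift (z w : Fin (d + d) → ℝ) (φ : 𝓢(EuclideanSpace ℝ (Fin d), ℂ)) :
    ∃ a : ℂ, ‖a‖ = 1 ∧ tfShift z (tfShift w φ) = a • tfShift (z + w) φ := by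
  refine ⟨Complex.exp (2 * Real.pi * Complex.I *
    (-(inner ℝ (WithLp.toLp 2 fun i => z (Fin.castAdd d i) : EuclideanSpace ℝ (Fin d))
      (WithLp.toLp 2 fun i => w (Fin.natAdd d i)) : ℝ) : ℝ)), ?_, ?_⟩
  · rw [Complex.norm_exp]; simp
  ext t
  rw [smul_apply, tfShift_apply, tfShift_apply, tfShift_apply, smul_eq_mul, ← mul_assoc,
    ← mul_assoc, ← Complex.exp_add, ← Complex.exp_add]
  have h1 : (WithLp.toLp 2 fun i => (z + w) (Fin.castAdd d i) : EuclideanSpace ℝ (Fin d))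
      = (WithLp.toLp 2 fun i => z (Fin.castAdd d i)) + WithLp.toLp 2 fun i => w (Fin.castAdd d i) :=
    rfl
  have h2 : (WithLp.toLp 2 fun i => (z + w) (Fin.natAdd d i) : EuclideanSpace ℝ (Fin d))
      = (WithLp.toLp 2 fun i => z (Fin.natAdd d i)) + WithLp.toLp 2 fun i => w (Fin.natAdd d i) :=
    rfl
  rw [h1, h2, inner_sub_left, inner_add_right, sub_sub]
  congr 2
  push_cast
  ring

/-- The time-frequency shift as a continuous linear map. -/
noncomputable def tfShiftCLM (z : Fin (d + d) → ℝ) :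
    𝓢(EuclideanSpace ℝ (Fin d), ℂ) →L[ℂ] 𝓢(EuclideanSpace ℝ (Fin d), ℂ) :=
  (SchwartzMap.smulLeftCLM ℂ (tfCharacter (WithLp.toLp 2 fun i => z (Fin.natAdd d i)))).comp
    (SchwartzMap.compSubConstCLM ℂ (WithLp.toLp 2 fun i => z (Fin.castAdd d i)))

theorem continuous_schwartzConj :
    Continuous (schwartzConj : 𝓢(EuclideanSpace ℝ (Fin d), ℂ) → 𝓢(EuclideanSpace ℝ (Fin d), ℂ)) :=
  (SchwartzMap.postcompCLM (Complex.conjCLE : ℂ →L[ℝ] ℂ)).continuous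

theorem schwartzConj_add (g h : 𝓢(EuclideanSpace ℝ (Fin d), ℂ)) :
    schwartzConj (g + h) = schwartzConj g + schwartzConj h := by
  ext t; simp [schwartzConj_apply]

theorem schwartzConj_smul (a : ℂ) (g : 𝓢(EuclideanSpace ℝ (Fin d), ℂ)) :
    schwartzConj (a • g) = conj a • schwartzConj g := by
  ext t; simp [schwartzConj_apply]

theorem continuous_gaborTransform (φ : 𝓢(EuclideanSpace ℝ (Fin d), ℂ))
    (f : TemperedDistribution (EuclideanSpace ℝ (Fin d)) ℂ) : Continuous (gaborTransform φ f) :=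
  f.continuous.comp (continuous_schwartzConj.comp (continuous_tfShift φ))

/-- The functional `g ↦ conj ⟨f, M_ξ T_x g⟩` at the point `z = (x, ξ)`. -/
noncomputable def conjGaborFunctional (f : TemperedDistribution (EuclideanSpace ℝ (Fin d)) ℂ)
    (z : Fin (d + d) → ℝ) : 𝓢(EuclideanSpace ℝ (Fin d), ℂ) →L[ℂ] ℂ where
  toFun g := conj (temperedPairing f (tfShiftCLM z g))
  map_add' g h := by
    simp only [temperedPairing]
    rw [map_add, schwartzConj_add, map_add, map_add]
  map_smul' a g := by
    simp only [temperedPairing]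
    rw [map_smul, schwartzConj_smul, map_smul, smul_eq_mul, map_mul, Complex.conj_conj,
      RingHom.id_apply, smul_eq_mul]
  cont := Complex.continuous_conj.comp
    (f.continuous.comp (continuous_schwartzConj.comp (tfShiftCLM z).continuous))

theorem norm_conjGaborFunctional_tfShift (φ : 𝓢(EuclideanSpace ℝ (Fin d), ℂ))
    (f : TemperedDistribution (EuclideanSpace ℝ (Fin d)) ℂ) (z w : Fin (d + d) → ℝ) :
    ‖conjGaborFunctional f z (tfShift w φ)‖ = ‖gaborTransform φ f (z + w)‖ := by
  obtain ⟨a, ha, h⟩ := tfShift_tfShift z w φ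
  change ‖conj (temperedPairing f (tfShift z (tfShift w φ)))‖ = ‖temperedPairing f (tfShift (z + w) φ)‖
  rw [RCLike.norm_conj, h, temperedPairing, temperedPairing, schwartzConj_smul, map_smul, norm_smul,
    RCLike.norm_conj, ha, one_mul]

/-- The reproducing formula is tested against `conjGaborFunctional f z`; the conjugation makes this
functional linear. On the shift of `φ` by `w` its modulus is `|V_φ f(z + w)|`. -/
theorem integral_norm_sq_mul_enorm_gaborTransform_le (φ : 𝓢(EuclideanSpace ℝ (Fin d), ℂ))
    (f : TemperedDistribution (EuclideanSpace ℝ (Fin d)) ℂ) (z : Fin (d + d) → ℝ) :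
    ‖((∫ x, ‖φ x‖ ^ 2 : ℝ) : ℂ)‖ₑ * ‖gaborTransform φ f z‖ₑ
      ≤ ∫⁻ w, ‖gaborKernel φ w‖ₑ * ‖gaborTransform φ f (z + w)‖ₑ := by
  have h := apply_eq_integral_of_eq_integral volume
    (h := fun w => gaborKernel φ w • tfShift w φ)
    ((continuous_gaborKernel φ).smul (continuous_tfShift φ)) (integrable_gaborKernel_seminorm φ)
    (g := ((∫ x, ‖φ x‖ ^ 2 : ℝ) : ℂ) • φ)
    (fun t => (integral_gaborKernel_mul_tfShift φ t).symm) (conjGaborFunctional f z)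
  simp_rw [map_smul, smul_eq_mul] at h
  have h1 : ‖conjGaborFunctional f z φ‖ₑ = ‖gaborTransform φ f z‖ₑ := by
    change ‖conj (gaborTransform φ f z)‖ₑ = _
    rw [← ofReal_norm, RCLike.norm_conj, ofReal_norm]
  rw [← h1, ← enorm_mul, h]
  refine (enorm_integral_le_lintegral_enorm _).trans_eq (lintegral_congr fun w => ?_)
  rw [enorm_mul, ← ofReal_norm (conjGaborFunctional f z _), norm_conjGaborFunctional_tfShift,
    ofReal_norm]

theorem exists_enorm_gaborTransform_le (φ : 𝓢(EuclideanSpace ℝ (Fin d), ℂ))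
    (f : TemperedDistribution (EuclideanSpace ℝ (Fin d)) ℂ) :
    ∃ C : ℝ≥0∞, C ≠ ∞ ∧ ∀ z, ‖gaborTransform φ f z‖ₑ
      ≤ C * ∫⁻ w, ‖gaborKernel φ w‖ₑ * ‖gaborTransform φ f (z + w)‖ₑ := by
  -- For the zero window the Gabor transform vanishes and any constant works; otherwise one divides
  -- by `‖φ‖²`.
  by_cases hφ : φ = 0
  · refine ⟨0, ENNReal.zero_ne_top, fun z => ?_⟩
    have h : gaborTransform φ f z = 0 := by
      have h1 : schwartzConj (tfShift z (0 : 𝓢(EuclideanSpace ℝ (Fin d), ℂ))) = 0 := by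
        ext t; simp [schwartzConj_apply, tfShift_apply]
      change f (schwartzConj (tfShift z φ)) = 0
      rw [hφ, h1, map_zero]
    simp [h]
  · have hN : ((∫ x, ‖φ x‖ ^ 2 : ℝ) : ℂ) ≠ 0 := by
      intro h0
      have h1 := (integral_eq_zero_iff_of_nonneg (μ := volume) (f := fun x => ‖φ x‖ ^ 2)
        (fun x => by positivity) ((φ.memLp 2).integrable_norm_pow two_ne_zero)).1 (by exact_mod_cast h0)
      have h2 := (Continuous.ae_eq_iff_eq volume (by fun_prop) continuous_zero).1 h1
      refine hφ (SchwartzMap.ext fun x => ?_)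
      simpa using congrFun h2 x
    refine ⟨‖((∫ x, ‖φ x‖ ^ 2 : ℝ) : ℂ)‖ₑ⁻¹, ENNReal.inv_ne_top.2 (enorm_ne_zero.2 hN), fun z => ?_⟩
    rw [mul_comm, ← div_eq_mul_inv, ENNReal.le_div_iff_mul_le (Or.inl (enorm_ne_zero.2 hN))
      (Or.inl enorm_ne_top), mul_comm]
    exact integral_norm_sq_mul_enorm_gaborTransform_le φ f z

end Reproducing

/-! ### Moderate weights and the weighted inequality -/

section Inclusion

variable {n : ℕ}

theorem polyWeight_nonneg (s : ℝ) (z : Fin n → ℝ) : 0 ≤ polyWeight s z := by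
  unfold polyWeight; positivity

theorem measurable_polyWeight (s : ℝ) : Measurable (polyWeight s : (Fin n → ℝ) → ℝ) := by
  have : Continuous fun z : Fin n → ℝ => 1 + ‖(WithLp.toLp 2 z : EuclideanSpace ℝ (Fin n))‖ :=
    continuous_const.add (PiLp.continuous_toLp 2 _).norm
  exact this.measurable.pow_const s

theorem polyWeight_le_of_le {s t : ℝ} (hst : t ≤ s) (z : Fin n → ℝ) :
    polyWeight t z ≤ polyWeight s z :=
  Real.rpow_le_rpow_of_exponent_le (by simp) hst

/-- Peetre's inequality: `1 + |y| ≤ (1 + |y + u|)(1 + |u|)` for `s ≥ 0`, and with `y` and `y + u`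
exchanged for `s < 0`. The error is stated with `∏ (1 + |u_i|)`, which both factorizes over
coordinates and is invariant under permutations. -/
theorem polyWeight_le_mul (s : ℝ) (y u : Fin n → ℝ) :
    polyWeight s y ≤ polyWeight s (y + u) * (∏ i, (1 + |u i|)) ^ ⌈|s|⌉₊ := by
  set Y : EuclideanSpace ℝ (Fin n) := WithLp.toLp 2 y
  set U : EuclideanSpace ℝ (Fin n) := WithLp.toLp 2 u with hU
  have hYU : (WithLp.toLp 2 (y + u) : EuclideanSpace ℝ (Fin n)) = Y + U := rfl
  have h1 : ‖Y‖ ≤ ‖Y + U‖ + ‖U‖ := by simpa using norm_sub_le (Y + U) U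
  have h2 : ‖Y + U‖ ≤ ‖Y‖ + ‖U‖ := norm_add_le _ _
  have key : (1 + ‖Y‖) ^ s ≤ (1 + ‖Y + U‖) ^ s * (1 + ‖U‖) ^ |s| := by
    rcases le_or_gt 0 s with hs | hs
    · rw [abs_of_nonneg hs, ← Real.mul_rpow (by positivity) (by positivity)]
      refine Real.rpow_le_rpow (by positivity) ?_ hs
      nlinarith [mul_nonneg (norm_nonneg (Y + U)) (norm_nonneg U)]
    · rw [abs_of_neg hs, Real.rpow_neg (by positivity), ← div_eq_mul_inv,
        le_div_iff₀ (by positivity), ← Real.mul_rpow (by positivity) (by positivity)]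
      refine Real.rpow_le_rpow_of_nonpos (by positivity) ?_ hs.le
      nlinarith [mul_nonneg (norm_nonneg Y) (norm_nonneg U)]
  have hU1 : (1 : ℝ) ≤ 1 + ‖U‖ := by simp
  unfold polyWeight
  rw [hYU]
  refine key.trans (mul_le_mul_of_nonneg_left ?_ (by positivity))
  calc (1 + ‖U‖) ^ |s| ≤ (1 + ‖U‖) ^ ((⌈|s|⌉₊ : ℕ) : ℝ) :=
        Real.rpow_le_rpow_of_exponent_le hU1 (Nat.le_ceil _)
    _ = (1 + ‖U‖) ^ ⌈|s|⌉₊ := Real.rpow_natCast _ _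
    _ ≤ _ := by gcongr; exact one_add_norm_toLp_le u

theorem measurePreserving_permuteCoords (c : Equiv.Perm (Fin n)) :
    MeasurePreserving (permuteCoords c) :=
  (volume_measurePreserving_piCongrLeft (fun _ => ℝ) c).symm

theorem prod_permuteCoords (c : Equiv.Perm (Fin n)) (u : Fin n → ℝ) :
    ∏ i, (1 + |permuteCoords c u i|) = ∏ i, (1 + |u i|) :=
  Equiv.prod_comp c fun i => 1 + |u i|

/-- The density `(1 + |s|)^{-2}` on the real line. -/
noncomputable def decayDensity (s : ℝ) : ℝ≥0∞ := ENNReal.ofReal ((1 + |s|) ^ 2)⁻¹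

theorem measurable_decayDensity : Measurable decayDensity := by
  unfold decayDensity; fun_prop

instance isFiniteMeasure_withDensity_decayDensity :
    IsFiniteMeasure ((volume : Measure ℝ).withDensity decayDensity) :=
  isFiniteMeasure_withDensity_ofReal integrable_inv_one_add_abs_sq.2

theorem withDensity_decayDensity_le : (volume : Measure ℝ).withDensity decayDensity ≤ volume := by
  conv_rhs => rw [← withDensity_one (μ := (volume : Measure ℝ))]
  refine withDensity_mono (ae_of_all _ fun s => ?_)
  refine ENNReal.ofReal_le_one.2 (inv_le_one_of_one_le₀ (one_le_pow₀ ?_))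
  simp

theorem prod_decayDensity (u : Fin n → ℝ) :
    ∏ i, decayDensity (u i) = ENNReal.ofReal ((∏ i, (1 + |u i|)) ^ 2)⁻¹ := by
  simp only [decayDensity]
  rw [← ENNReal.ofReal_prod_of_nonneg fun i _ => by positivity]
  simp [Finset.prod_inv_distrib, Finset.prod_pow]

theorem exists_weighted_gaborTransform_le {d : ℕ} (φ : 𝓢(EuclideanSpace ℝ (Fin d), ℂ))
    (f : TemperedDistribution (EuclideanSpace ℝ (Fin d)) ℂ) (c : Equiv.Perm (Fin (d + d)))
    {s t : ℝ} (hst : t ≤ s) :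
    ∃ C : ℝ≥0∞, C ≠ ∞ ∧ ∀ y,
      ‖(gaborTransform φ f ∘ permuteCoords c) y * (polyWeight t y : ℂ)‖ₑ ≤
        C * ∫⁻ u, ‖(gaborTransform φ f ∘ permuteCoords c) (y + u) * (polyWeight s (y + u) : ℂ)‖ₑ
          ∂(Measure.pi fun _ => (volume : Measure ℝ).withDensity decayDensity) := by
  obtain ⟨C, hC, hCle⟩ := exists_enorm_gaborTransform_le φ f
  -- The power `⌈|s|⌉₊` pays for moving the weight from `y` to `y + u`; the power `2` produces the
  -- product of the densities `decayDensity`.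
  obtain ⟨D, hD⟩ := exists_gaborKernel_mul_prod_le φ (⌈|s|⌉₊ + 2)
  have hw : ∀ (a : ℝ) (y : Fin (d + d) → ℝ),
      ‖(polyWeight a y : ℂ)‖ₑ = ENNReal.ofReal (polyWeight a y) := fun a y => by
    rw [← ofReal_norm, Complex.norm_of_nonneg (polyWeight_nonneg a y)]
  have hVm := (continuous_gaborTransform φ f).measurable
  have hKm := (continuous_gaborKernel φ).measurable
  have hpm := (measurePreserving_permuteCoords c).measurable
  have hprod : Measurable fun u : Fin (d + d) → ℝ => ∏ i, decayDensity (u i) :=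
    Finset.measurable_prod _ fun i _ => measurable_decayDensity.comp (measurable_pi_apply i)
  refine ⟨C * ENNReal.ofReal D, ENNReal.mul_ne_top hC ENNReal.ofReal_ne_top, fun y => ?_⟩
  have hHm : Measurable fun u : Fin (d + d) → ℝ =>
      ‖(gaborTransform φ f ∘ permuteCoords c) (y + u) * (polyWeight s (y + u) : ℂ)‖ₑ :=
    ((hVm.comp (hpm.comp (measurable_const_add y))).mul (Complex.measurable_ofReal.comp
      ((measurable_polyWeight s).comp (measurable_const_add y)))).enorm
  rw [pi_withDensity measurable_decayDensity,
    lintegral_withDensity_eq_lintegral_mul _ hprod hHm, mul_assoc,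
    ← lintegral_const_mul _ (hprod.mul hHm)]
  calc ‖(gaborTransform φ f ∘ permuteCoords c) y * (polyWeight t y : ℂ)‖ₑ
      ≤ C * (∫⁻ w, ‖gaborKernel φ w‖ₑ * ‖gaborTransform φ f (permuteCoords c y + w)‖ₑ)
          * ENNReal.ofReal (polyWeight t y) := by
        rw [enorm_mul, hw]
        gcongr
        exact hCle _
    _ = C * ∫⁻ u, ‖gaborKernel φ (permuteCoords c u)‖ₑ
          * ‖gaborTransform φ f (permuteCoords c (y + u))‖ₑ * ENNReal.ofReal (polyWeight t y) := by
        -- Substituting `w = 𝔠 u` and using linearity of `𝔠` turns the phase-space shift into a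
        -- shift in the permuted coordinates.
        rw [mul_assoc, ← (measurePreserving_permuteCoords c).lintegral_comp
          (f := fun w => ‖gaborKernel φ w‖ₑ * ‖gaborTransform φ f (permuteCoords c y + w)‖ₑ)
          (hKm.enorm.mul (hVm.comp (measurable_const_add _)).enorm),
          ← lintegral_mul_const' _ _ ENNReal.ofReal_ne_top]
        rfl
    _ ≤ _ := by
        refine mul_le_mul_right (lintegral_mono fun u => ?_) C
        change _ ≤ ENNReal.ofReal D * ((∏ i, decayDensity (u i)) *
          ‖gaborTransform φ f (permuteCoords c (y + u)) * (polyWeight s (y + u) : ℂ)‖ₑ)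
        rw [enorm_mul, hw, prod_decayDensity]
        have h1 : ‖gaborKernel φ (permuteCoords c u)‖ * polyWeight t y
            ≤ D * (((∏ i, (1 + |u i|)) ^ 2)⁻¹ * polyWeight s (y + u)) := by
          have hP : 0 < ∏ i, (1 + |u i|) := zero_lt_one.trans_le (one_le_prod_one_add_abs u)
          have hk := hD (permuteCoords c u)
          rw [prod_permuteCoords] at hk
          have hwt := (polyWeight_le_of_le hst y).trans (polyWeight_le_mul s y u)
          set P := ∏ i, (1 + |u i|)
          have hw0 := polyWeight_nonneg s (y + u)
          calc _ ≤ ‖gaborKernel φ (permuteCoords c u)‖ * (polyWeight s (y + u) * P ^ ⌈|s|⌉₊) := by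
                gcongr
            _ = (‖gaborKernel φ (permuteCoords c u)‖ * P ^ (⌈|s|⌉₊ + 2))
                  * ((P ^ 2)⁻¹ * polyWeight s (y + u)) := by
                rw [pow_add]; field_simp
            _ ≤ _ := by gcongr
        have hD0 : 0 ≤ D := le_trans (by positivity) (hD 0)
        calc _ = ‖gaborTransform φ f (permuteCoords c (y + u))‖ₑ *
              ENNReal.ofReal (‖gaborKernel φ (permuteCoords c u)‖ * polyWeight t y) := by
              rw [ENNReal.ofReal_mul (norm_nonneg _), ofReal_norm]; ring
          _ ≤ ‖gaborTransform φ f (permuteCoords c (y + u))‖ₑ *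
              ENNReal.ofReal (D * (((∏ i, (1 + |u i|)) ^ 2)⁻¹ * polyWeight s (y + u))) := by
              gcongr
          _ = _ := by
              rw [ENNReal.ofReal_mul hD0, ENNReal.ofReal_mul (by positivity)]; ring

end Inclusion

theorem lemma4p4 (d : ℕ) (φ : SchwartzMap (EuclideanSpace ℝ (Fin d)) ℂ)
    (c : Equiv.Perm (Fin (d + d))) (s t : ℝ) (hst : t ≤ s)
    (p r : Fin (d + d) → ℝ≥0∞) (hp : ∀ i, 1 ≤ p i) (hpr : ∀ i, p i ≤ r i) :
    mixedModulationSpace φ c (polyWeight s) p ⊆ mixedModulationSpace φ c (polyWeight t) r := by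
  intro f hf
  obtain ⟨C, hC, hCle⟩ := exists_weighted_gaborTransform_le φ f c hst
  obtain ⟨D, hD, hDle⟩ := exists_iteratedLpNorm_lintegral_translate_le
    ((volume : Measure ℝ).withDensity decayDensity) withDensity_decayDensity_le hp hpr
  have hHm : Measurable fun y : Fin (d + d) → ℝ =>
      ‖(gaborTransform φ f ∘ permuteCoords c) y * (polyWeight s y : ℂ)‖ₑ :=
    (((continuous_gaborTransform φ f).measurable.comp
      (measurePreserving_permuteCoords c).measurable).mul
      (Complex.measurable_ofReal.comp (measurable_polyWeight s))).enorm
  have hle : mixedModulationNorm φ c (polyWeight t) r f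
      ≤ C * (D * mixedModulationNorm φ c (polyWeight s) p f) :=
    (iteratedLpNorm_mono r hCle).trans ((iteratedLpNorm_const_mul_le r hC _).trans
      (mul_le_mul_right (hDle _ hHm) C))
  exact hle.trans_lt (ENNReal.mul_lt_top hC.lt_top (ENNReal.mul_lt_top hD.lt_top hf))
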